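/- Let $G=(V,E)$ be a finite multigraph (loops and parallel edges allowed) with a reflective symmetry: an involution $\phi$ of $V$ and of $E$, compatible with incidence, together with partitions $V=V_L\sqcup V^\phi\sqcup V_R$ and $E=E_L\sqcup E^\phi\sqcup E_R$ (left, fixed, right) such that $V^\phi$ and $E^\phi$ are the sets of $\phi$-fixed vertices and edges, $\phi$ exchanges $V_L$ with $V_R$ and $E_L$ with $E_R$, and no edge crosses the axis: the endpoints of an edge of $E_L$, $E^\phi$, $E_R$ lie in $V_L\cup V^\phi$, $V^\phi$, $V_R\cup V^\phi$ respectively. A set of edges is regarded as a subgraph whose vertices are the endpoints of these edges. Let $G_+=(V_+,E_+)$ be the graph obtained from the subgraph $E_L\cup E^\phi$ by subdividing every edge of $E^\phi$ once, and $G_-=(V_-,E_-)$ the graph obtained from the subgraph $E_R$ by identifying its $\phi$-fixed vertices with each other. For an oriented multigraph $H$ with boundary map $\partial$ and transpose $\partial^t$, and a commutative ring $A$, let $Z_A=\ker(\partial: A E(H)\to A V(H))$ and $B_A=\operatorname{im}(\partial^t: A V(H)\to A E(H))$. The critical group of $H$ is $K(H)=\mathbf Z E(H)/(Z_{\mathbf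 Z}+B_{\mathbf Z})$, and a bicycle of $H$ is an element of $Z_{\mathbf Z/2}\cap B_{\mathbf Z/2}\subseteq(\mathbf Z/2)E(H)$. Then $G$ has an orientation for which $\phi$ is an automorphism of directed graphs. Fix any such orientation, and give $G_+$ and $G_-$ the induced orientations (an edge $u\to v$ of $E^\phi$ with subdividing vertex $m$ becomes $u\to m\to v$). Let $f:\mathbf Z E_+\oplus\mathbf Z E_-\to\mathbf Z E$ be the linear map with $f(e,0)=e+\phi(e)$ for $e\in E_L$, $f(e',0)=e$ for each of the two edges $e'$ obtained by subdividing $e\in E^\phi$, and $f(0,e)=e-\phi(e)$ for $e\in E_-=E_R$. Let $\psi$ be the involution of $E_+\sqcup E_-$ that exchanges $e\in E_L$ with $\phi(e)\in E_R$ and exchanges the two edges obtained by subdividing an edge of $E^\phi$. Then: 1. $f$ induces a group homomorphism $f^*:K(G_+)\oplus K(G_-)\to K(G)$. 2. $2\ker(f^*)=0$ and $2\operatorname{coker}(f^*)=0$. 3. $\ker(f^*)$ is isomorphic to the space of $\psi$-fixed bicycles of the disjoint union $G_+\cup G_-$. 4. $\operatorname{coker}(f^*)$ is isomorphic to the space of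 $\phi$-fixed bicycles of $G$ that contain no edge of $E^\phi$. If the edges of $E^\phi$ form a forest (as they do when $\phi$ comes from a planar drawing that is symmetric about a line on which the fixed edges lie), then $\operatorname{coker}(f^*)$ is isomorphic to the space of all $\phi$-fixed bicycles of $G$. 5. If $G_+$ is connected, $V^\phi\neq\emptyset$, and every vertex of $V^\phi$ is an endpoint of some edge of $G$, then $$\frac{|\operatorname{coker}(f^*)|}{|\ker(f^*)|}=\frac{|K(G)|}{|K(G_+)\oplus K(G_-)|}=2^{|V^\phi|-|E^\phi|-1}.$$ -/

import Mathlib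

universe u v

/-- A multigraph with vertex set `V` and edge set `E`; loops and parallel edges are allowed.
Each edge has an unordered pair of endpoints. -/
structure Multigraph (V : Type u) (E : Type v) where
  ends : E → Sym2 V

/-- A multigraph is connected when it has a vertex and any two of its vertices are joined by a
walk. -/
def Multigraph.Connected {V : Type u} {E : Type v} (G : Multigraph V E) : Prop :=
  (SimpleGraph.fromEdgeSet (Set.range G.ends)).Connected

/-- A multigraph all of whose edges have been given an orientation. -/
structure OrientedMultigraph (V : Type u) (E : Type v) where
  tail : E → V
  head : E → V

namespace OrientedMultigraph

variable {V : Type u} {E : Type v} (D : OrientedMultigraph V E)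

/-- The underlying (unoriented) multigraph. -/
def toMultigraph : Multigraph V E where
  ends e := s(D.tail e, D.head e)

open Classical in
/-- The boundary map `∂ : R E → R V`, which sends an oriented edge `uv` to `v - u`. -/
noncomputable def boundary (R : Type*) [CommRing R] [Fintype E] : (E → R) →ₗ[R] (V → R) :=
  Fintype.linearCombination R
    (fun e => (Pi.single (D.head e) 1 - Pi.single (D.tail e) 1 : V → R))

/-- The coboundary map `∂ᵗ : R V → R E`, the transpose of `∂`. -/
def coboundary (R : Type*) [CommRing R] : (V → R) →ₗ[R] (E → R) where
  toFun w e := w (D.head e) - w (D.tail e)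
  map_add' w w' := by ext e; simp only [Pi.add_apply]; ring
  map_smul' c w := by ext e; simp only [Pi.smul_apply, smul_eq_mul, RingHom.id_apply]; ring

/-- The cycle space `Z`, the kernel of `∂`. -/
noncomputable def cycleSpace (R : Type*) [CommRing R] [Fintype E] : Submodule R (E → R) :=
  LinearMap.ker (D.boundary R)

/-- The bond (cut) space `B`, the image of `∂ᵗ`. -/
def bondSpace (R : Type*) [CommRing R] : Submodule R (E → R) :=
  LinearMap.range (D.coboundary R)

/-- The critical group `K = ℤE / (Z + B)`. -/
abbrev CriticalGroup [Fintype E] : Type v :=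
  (E → ℤ) ⧸ (D.cycleSpace ℤ ⊔ D.bondSpace ℤ)

/-- The class in the critical group of an element of `ℤE`. -/
noncomputable def toCriticalGroup [Fintype E] : (E → ℤ) →ₗ[ℤ] D.CriticalGroup :=
  (D.cycleSpace ℤ ⊔ D.bondSpace ℤ).mkQ

/-- The bicycle space `Z ∩ B` over `ℤ/2`. -/
noncomputable def bicycleSpace [Fintype E] : Submodule (ZMod 2) (E → ZMod 2) :=
  D.cycleSpace (ZMod 2) ⊓ D.bondSpace (ZMod 2)

/-- The disjoint union of two oriented multigraphs. -/
def disjointUnion {V' : Type*} {E' : Type*} (D' : OrientedMultigraph V' E') :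
    OrientedMultigraph (V ⊕ V') (E ⊕ E') where
  tail := Sum.map D.tail D'.tail
  head := Sum.map D.head D'.head

end OrientedMultigraph

/-- For a map `σ : I → I`, the space of `σ`-invariant vectors in `(ℤ/2)I`. -/
def invariantVectors {I : Type*} (σ : I → I) : Submodule (ZMod 2) (I → ZMod 2) where
  carrier := {x | ∀ i, x (σ i) = x i}
  add_mem' hx hy i := by simp only [Pi.add_apply, hx i, hy i]
  zero_mem' _ := rfl
  smul_mem' c x hx i := by simp only [Pi.smul_apply, hx i]

/-- A reflective symmetry of a multigraph: an involution `φ` on vertices and edges, together with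
the partition of vertices and of edges into those to the left of the axis of symmetry (side `-1`),
those on the axis (side `0`) and those to its right (side `1`).  Exactly the `φ`-fixed vertices and
edges lie on the axis, `φ` exchanges left and right, and no edge crosses the axis: the endpoints of
an edge lie on the axis or on the same side as the edge.  In particular the endpoints of a
`φ`-fixed edge are `φ`-fixed. -/
structure ReflectiveSymmetry {V : Type u} {E : Type v} (G : Multigraph V E) where
  φV : V → V
  φE : E → E
  φV_involutive : Function.Involutive φV
  φE_involutive : Function.Involutive φE
  ends_φE : ∀ e, G.ends (φE e) = (G.ends e).map φV
  sideV : V → SignType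
  sideE : E → SignType
  sideV_eq_zero_iff : ∀ v, sideV v = 0 ↔ φV v = v
  sideE_eq_zero_iff : ∀ e, sideE e = 0 ↔ φE e = e
  sideV_φV : ∀ v, sideV (φV v) = -sideV v
  sideE_φE : ∀ e, sideE (φE e) = -sideE e
  side_of_mem_ends : ∀ e, ∀ v ∈ G.ends e, sideV v = 0 ∨ sideV v = sideE e

namespace ReflectiveSymmetry

variable {V : Type u} {E : Type v} {G : Multigraph V E} (S : ReflectiveSymmetry G)

/-- An orientation `D` of `G` such that `φ` is an involution of directed graphs. -/
structure IsInvariantOrientation (D : OrientedMultigraph V E) : Prop where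
  toMultigraph_eq : D.toMultigraph = G
  tail_φE : ∀ e, D.tail (S.φE e) = S.φV (D.tail e)
  head_φE : ∀ e, D.head (S.φE e) = S.φV (D.head e)

/-- The edges on the left of the axis. -/
abbrev LeftEdge : Type v := {e : E // S.sideE e = -1}

/-- The edges on the right of the axis. -/
abbrev RightEdge : Type v := {e : E // S.sideE e = 1}

/-- The edges on the axis, which are the `φ`-fixed edges. -/
abbrev AxisEdge : Type v := {e : E // S.sideE e = 0}

/-- The edges of `G₊`: the left edges of `G`, and two edges `(e, false)`, `(e, true)` for each
subdivided `φ`-fixed edge `e`. -/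
abbrev PlusEdge : Type v := S.LeftEdge ⊕ (S.AxisEdge × Bool)

/-- The vertices of `G₊`: the endpoints of the left edges and of the `φ`-fixed edges of `G`, and a
new vertex for each `φ`-fixed edge. -/
abbrev PlusVertex : Type (max u v) :=
  {v : V // ∃ e, (S.sideE e = -1 ∨ S.sideE e = 0) ∧ v ∈ G.ends e} ⊕ S.AxisEdge

/-- The edges of `G₋`. -/
abbrev MinusEdge : Type v := S.RightEdge

/-- The endpoints of the right edges. -/
abbrev RightEndpoint : Type u := {v : V // ∃ e, S.sideE e = 1 ∧ v ∈ G.ends e}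

/-- The vertices of `G₋`: the endpoints of the right edges, where all `φ`-fixed ones are
identified with each other. -/
abbrev MinusVertex : Type u :=
  Quot (fun a b : S.RightEndpoint => S.φV a = a ∧ S.φV b = b)

variable {S} {D : OrientedMultigraph V E}

theorem IsInvariantOrientation.tail_mem (h : S.IsInvariantOrientation D) (e : E) :
    D.tail e ∈ G.ends e := by
  rw [← h.toMultigraph_eq]
  exact Sym2.mem_mk_left _ _

theorem IsInvariantOrientation.head_mem (h : S.IsInvariantOrientation D) (e : E) :
    D.head e ∈ G.ends e := by
  rw [← h.toMultigraph_eq]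
  exact Sym2.mem_mk_right _ _

/-- The graph `G₊` with the induced orientation: a `φ`-fixed edge `e = uv` is subdivided into
`(e, false)`, from `u` to the new vertex, and `(e, true)`, from the new vertex to `v`. -/
def plus (h : S.IsInvariantOrientation D) : OrientedMultigraph S.PlusVertex S.PlusEdge where
  tail
    | .inl e => .inl ⟨D.tail e, e, .inl e.2, h.tail_mem e⟩
    | .inr (e, false) => .inl ⟨D.tail e, e, .inr e.2, h.tail_mem e⟩
    | .inr (e, true) => .inr e
  head
    | .inl e => .inl ⟨D.head e, e, .inl e.2, h.head_mem e⟩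
    | .inr (e, false) => .inr e
    | .inr (e, true) => .inl ⟨D.head e, e, .inr e.2, h.head_mem e⟩

/-- The graph `G₋` with the induced orientation. -/
def minus (h : S.IsInvariantOrientation D) : OrientedMultigraph S.MinusVertex S.MinusEdge where
  tail e := Quot.mk _ ⟨D.tail e, e, e.2, h.tail_mem e⟩
  head e := Quot.mk _ ⟨D.head e, e, e.2, h.head_mem e⟩

variable (S)

open Classical in
/-- The linear map `f : ℤE₊ ⊕ ℤE₋ → ℤE`.  It sends a left edge `e` of `G₊` to `e + φ(e)`, each of
the two edges obtained by subdividing a `φ`-fixed edge `e` to `e`, and an edge `e` of `G₋` to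
`e - φ(e)`. -/
noncomputable def f [Fintype E] :
    ((S.PlusEdge → ℤ) × (S.MinusEdge → ℤ)) →ₗ[ℤ] (E → ℤ) :=
  LinearMap.coprod
    (Fintype.linearCombination ℤ (Sum.elim
      (fun e : S.LeftEdge => (Pi.single (e : E) 1 + Pi.single (S.φE e) 1 : E → ℤ))
      (fun p : S.AxisEdge × Bool => (Pi.single (p.1 : E) 1 : E → ℤ))))
    (Fintype.linearCombination ℤ
      (fun e : S.MinusEdge => (Pi.single (e : E) 1 - Pi.single (S.φE e) 1 : E → ℤ)))

/-- The involution `ψ` on the edges of `G₊ ∪ G₋`: it exchanges the two edges obtained by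
subdividing a `φ`-fixed edge, and it exchanges a left edge `e` of `G₊` with the edge `φ(e)` of
`G₋`. -/
def ψ : S.PlusEdge ⊕ S.MinusEdge → S.PlusEdge ⊕ S.MinusEdge
  | .inl (.inl e) => .inr ⟨S.φE e, by rw [S.sideE_φE, e.2]; rfl⟩
  | .inl (.inr (e, b)) => .inl (.inr (e, !b))
  | .inr e => .inl (.inl ⟨S.φE e, by rw [S.sideE_φE, e.2]⟩)

/-- The `φ`-fixed bicycles of `G`. -/
noncomputable def fixedBicycles [Fintype E] (D : OrientedMultigraph V E) :
    Submodule (ZMod 2) (E → ZMod 2) :=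
  D.bicycleSpace ⊓ invariantVectors S.φE

/-- The `φ`-fixed bicycles of `G` that contain no `φ`-fixed edge, that is, the bicycles that are
sums of elements `e + φ(e)` with `e` not fixed. -/
noncomputable def freeFixedBicycles [Fintype E] (D : OrientedMultigraph V E) :
    Submodule (ZMod 2) (E → ZMod 2) :=
  S.fixedBicycles D ⊓
    { carrier := {x | ∀ e, S.φE e = e → x e = 0}
      add_mem' := fun hx hy e he => by simp only [Pi.add_apply, hx e he, hy e he, add_zero]
      zero_mem' := fun _ _ => rfl
      smul_mem' := fun c x hx e he => by simp only [Pi.smul_apply, hx e he, smul_zero] }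

variable {S} in
/-- The `ψ`-fixed bicycles of `G₊ ∪ G₋`. -/
noncomputable def plusMinusFixedBicycles [Fintype E] (h : S.IsInvariantOrientation D) :
    Submodule (ZMod 2) (S.PlusEdge ⊕ S.MinusEdge → ZMod 2) :=
  ((plus h).disjointUnion (minus h)).bicycleSpace ⊓ invariantVectors S.ψ

/-- The `φ`-fixed edges of `G` form a forest: none is a loop, no two are parallel, and they contain
no cycle. -/
def FixedEdgesFormForest : Prop :=
  (∀ e, S.φE e = e → ¬ (G.ends e).IsDiag) ∧
  (∀ e e', S.φE e = e → S.φE e' = e' → G.ends e = G.ends e' → e = e') ∧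
  (SimpleGraph.fromEdgeSet {p | ∃ e, S.φE e = e ∧ G.ends e = p}).IsAcyclic

end ReflectiveSymmetry

/-! ### Cycles, bonds and the critical group. -/

namespace OrientedMultigraph

variable {V : Type u} {E : Type v} (D : OrientedMultigraph V E)

/-! Let `g` be the transpose of `f`, and write Z, B and Z', B' for the cycles and bonds of G and of
G₊ ⊔ G₋. Folding and unfolding potentials along the axis shows that `f` and `g` both preserve bonds;
as cycles are the orthogonal complement of bonds, adjointness makes both preserve cycles. Moreover
f∘g = 2, and g∘f = 2 modulo B', exactly so on Z', because a cycle of G₊ agrees on the two halves of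
a subdivided edge. Hence `f` and `g` induce maps of critical groups that are inverse up to the
factor 2, and 2 kills kernel and cokernel. These properties are collected in `HalfIsomorphism`.

The cokernel is ℤE/(Z + B + im f). The denominator contains 2ℤE, so the dual of this 𝔽₂-space
consists of the vectors mod 2 orthogonal to Z, B and im f: the bicycles killed by `g`
(`nonempty_coker_equiv`). If y represents a kernel element and f y = z + b, then g z mod 2 is a
bicycle killed by `f`, and this assignment is an isomorphism (`nonempty_ker_equiv`). Modulo 2, being
killed by `g` means being φ-invariant and zero on the axis; being killed by `f` means being
ψ-invariant.

For the ratio, take the Laplace form mod 2 on potentials of G₊ and the subspace U of potentials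
vanishing on V^φ. U ∩ rad is isomorphic to the ψ-fixed bicycles. U^⊥ maps onto the φ-fixed bicycles
avoiding the axis, with a kernel of dimension 1 + |E^φ|. Now use dim U + dim U^⊥ = dim(whole space)
+ dim(U ∩ rad), where U has codimension |V^φ|. -/

theorem coboundary_apply (R : Type*) [CommRing R] (w : V → R) (e : E) :
    D.coboundary R w e = w (D.head e) - w (D.tail e) := rfl

theorem mem_bondSpace {R : Type*} [CommRing R] {x : E → R} :
    x ∈ D.bondSpace R ↔ ∃ w : V → R, ∀ e, w (D.head e) - w (D.tail e) = x e := by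
  constructor
  · rintro ⟨w, rfl⟩
    exact ⟨w, fun e => rfl⟩
  · rintro ⟨w, hw⟩
    exact ⟨w, funext hw⟩

theorem mem_bondSpace_of_two_smul {x : E → ℤ} (hx : (2 : ℤ) • x ∈ D.bondSpace ℤ) :
    x ∈ D.bondSpace ℤ := by
  rw [mem_bondSpace] at hx ⊢
  obtain ⟨w, hw⟩ := hx
  -- Floor division suffices: the values of `w` at the ends of an edge have the same parity, so
  -- halving divides their difference exactly.
  refine ⟨fun v => w v / 2, fun e => ?_⟩
  have := hw e
  simp only [Pi.smul_apply, smul_eq_mul] at this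
  dsimp only
  omega

variable [Fintype E]

theorem boundary_apply_eq_sum {R : Type*} [CommRing R] (x : E → R) (v : V) :
    D.boundary R x v = ∑ e, x e * D.coboundary R (open Classical in Pi.single v 1) e := by
  classical
  simp only [boundary, Fintype.linearCombination_apply, Finset.sum_apply, Pi.smul_apply,
    Pi.sub_apply, smul_eq_mul, coboundary_apply]
  refine Finset.sum_congr rfl fun e _ => ?_
  congr 1
  simp only [Pi.single_apply, eq_comm]

theorem sum_boundary_mul {R : Type*} [CommRing R] [Fintype V] (x : E → R) (w : V → R) :
    ∑ v, D.boundary R x v * w v = ∑ e, x e * D.coboundary R w e := by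
  classical
  simp only [boundary_apply_eq_sum, Finset.sum_mul, coboundary_apply]
  rw [Finset.sum_comm]
  refine Finset.sum_congr rfl fun e _ => ?_
  simp [mul_assoc, ← Finset.mul_sum, sub_mul, Finset.sum_sub_distrib, Pi.single_apply]

/-- The cycle space is the orthogonal complement of the bond space. -/
theorem mem_cycleSpace_iff [Finite V] {R : Type*} [CommRing R] {x : E → R} :
    x ∈ D.cycleSpace R ↔ ∀ b ∈ D.bondSpace R, x ⬝ᵥ b = 0 := by
  have := Fintype.ofFinite V
  constructor
  · rintro hx _ ⟨w, rfl⟩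
    have h := D.sum_boundary_mul x w
    rw [LinearMap.mem_ker.mp hx] at h
    simpa [dotProduct] using h.symm
  · intro h
    refine LinearMap.mem_ker.mpr (funext fun v => ?_)
    rw [boundary_apply_eq_sum]
    exact h _ ⟨_, rfl⟩

theorem mem_cycleSpace_iff' [Finite V] {R : Type*} [CommRing R] {x : E → R} :
    x ∈ D.cycleSpace R ↔ ∀ w : V → R, ∑ e, x e * (w (D.head e) - w (D.tail e)) = 0 := by
  rw [mem_cycleSpace_iff]
  constructor
  · exact fun h w => h _ ⟨w, rfl⟩
  · rintro h _ ⟨w, rfl⟩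
    exact h w

theorem linearForm_eq_dotProduct {F I : Type*} [CommRing F] [Fintype I] [DecidableEq I]
    (φ : (I → F) →ₗ[F] F) (y : I → F) : φ y = (fun i => φ (Pi.single i 1)) ⬝ᵥ y := by
  rw [LinearMap.pi_apply_eq_sum_univ φ y]
  refine Finset.sum_congr rfl fun i _ => ?_
  rw [smul_eq_mul, mul_comm]
  congr 2
  ext j
  simp [Pi.single_apply, eq_comm]

/-- Vectors outside a subspace of coordinate space are detected by the dot product. -/
theorem exists_dotProduct_ne_zero {F I : Type*} [Field F] [Fintype I] {W : Submodule F (I → F)}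
    {x : I → F} (hx : x ∉ W) : ∃ a : I → F, (∀ y ∈ W, a ⬝ᵥ y = 0) ∧ a ⬝ᵥ x ≠ 0 := by
  classical
  obtain ⟨φ, h1, h2⟩ := Submodule.exists_le_ker_of_notMem hx
  refine ⟨fun i => φ (Pi.single i 1), fun y hy => ?_, ?_⟩
  · rw [← linearForm_eq_dotProduct]
    exact h2 hy
  · rwa [← linearForm_eq_dotProduct]

/-- Over a field, the bond space is the orthogonal complement of the cycle space. -/
theorem mem_bondSpace_iff [Finite V] {F : Type*} [Field F] {x : E → F} :
    x ∈ D.bondSpace F ↔ ∀ z ∈ D.cycleSpace F, z ⬝ᵥ x = 0 := by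
  constructor
  · exact fun hx z hz => D.mem_cycleSpace_iff.mp hz x hx
  · intro h
    by_contra hx
    obtain ⟨a, ha, hax⟩ := exists_dotProduct_ne_zero hx
    exact hax (h a (D.mem_cycleSpace_iff.mpr ha))

theorem mem_cycleSpace_of_two_smul {x : E → ℤ} (hx : (2 : ℤ) • x ∈ D.cycleSpace ℤ) :
    x ∈ D.cycleSpace ℤ := by
  simp only [cycleSpace, LinearMap.mem_ker, map_smul] at hx ⊢
  exact (smul_eq_zero.mp hx).resolve_left two_ne_zero

theorem eq_zero_of_mem_cycleSpace_of_mem_bondSpace [Finite V] {x : E → ℤ}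
    (hz : x ∈ D.cycleSpace ℤ) (hb : x ∈ D.bondSpace ℤ) : x = 0 :=
  dotProduct_self_eq_zero.mp (D.mem_cycleSpace_iff.mp hz x hb)

/-- The image of the boundary map has torsion-free cokernel. -/
theorem mem_range_boundary_of_two_smul [Finite V] {u : V → ℤ}
    (hu : (2 : ℤ) • u ∈ LinearMap.range (D.boundary ℤ)) :
    u ∈ LinearMap.range (D.boundary ℤ) := by
  classical
  have := Fintype.ofFinite V
  let r : V → V → Prop := fun a b => ∃ e, D.tail e = a ∧ D.head e = b
  -- `T` moves all weight to one representative vertex per component. It kills boundaries and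
  -- changes `u` only by a boundary, so `u` is a boundary as soon as `T u = 0`; this condition is
  -- insensitive to the factor 2.
  let ρ : V → V := fun a => (Quot.mk r a).out
  let T : (V → ℤ) →ₗ[ℤ] (V → ℤ) :=
    Fintype.linearCombination ℤ fun v => (Pi.single (ρ v) 1 : V → ℤ)
  have hsingle : ∀ e, D.boundary ℤ (Pi.single e 1) =
      Pi.single (D.head e) 1 - Pi.single (D.tail e) 1 := fun e => by
    simp [boundary, Fintype.linearCombination_apply_single]
  have hgen : ∀ a b, Relation.EqvGen r a b →
      (Pi.single a 1 - Pi.single b 1 : V → ℤ) ∈ LinearMap.range (D.boundary ℤ) := by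
    intro a b hab
    induction hab with
    | rel a b h =>
      obtain ⟨e, rfl, rfl⟩ := h
      rw [← neg_sub, ← hsingle]
      exact neg_mem ⟨_, rfl⟩
    | refl a => simp
    | symm a b _ ih =>
      rw [← neg_sub]
      exact neg_mem ih
    | trans a b c _ _ ih1 ih2 =>
      rw [← sub_add_sub_cancel]
      exact add_mem ih1 ih2
  have hT : ∀ x, T (D.boundary ℤ x) = 0 := by
    intro x
    have : T ∘ₗ D.boundary ℤ = 0 := by
      refine LinearMap.pi_ext' fun e => LinearMap.ext_ring ?_
      have hρ : ρ (D.head e) = ρ (D.tail e) :=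
        congrArg Quot.out (Quot.sound (⟨e, rfl, rfl⟩ : r (D.tail e) (D.head e))).symm
      simp [hsingle, T, Fintype.linearCombination_apply_single, hρ]
    exact LinearMap.congr_fun this x
  have hdiff : u - T u ∈ LinearMap.range (D.boundary ℤ) := by
    have : u - T u = ∑ v, u v • (Pi.single v 1 - Pi.single (ρ v) 1 : V → ℤ) := by
      simp only [smul_sub, Finset.sum_sub_distrib, T, Fintype.linearCombination_apply]
      congr 1
      exact pi_eq_sum_univ' u
    rw [this]
    refine sum_mem fun v _ => Submodule.smul_mem _ _ (hgen _ _ ?_)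
    exact Quot.eqvGen_exact (Quot.out_eq (Quot.mk r v)).symm
  obtain ⟨x, hx⟩ := hu
  have h0 : T u = 0 := by
    have := hT x
    rw [hx, map_smul] at this
    exact (smul_eq_zero.mp this).resolve_left two_ne_zero
  simpa [h0] using hdiff

/-- The finiteness of the critical group. -/
theorem finite_criticalGroup [Finite V] : Finite D.CriticalGroup := by
  refine Submodule.finiteQuotientOfFreeOfRankEq _ (le_antisymm (Submodule.finrank_le _) ?_)
  set Z := D.cycleSpace ℤ
  set B := D.bondSpace ℤ
  let pair : (E → ℤ) →ₗ[ℤ] (B →ₗ[ℤ] ℤ) :=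
    { toFun := fun x => (dotProductBilin ℤ ℤ x) ∘ₗ B.subtype
      map_add' := fun x y => by ext; simp
      map_smul' := fun c x => LinearMap.ext fun b => smul_dotProduct c x (b : E → ℤ) }
  have hker : Z = LinearMap.ker pair := by
    ext x
    rw [D.mem_cycleSpace_iff, LinearMap.mem_ker, LinearMap.ext_iff]
    simp [pair, B]
  -- As Z is the kernel of the pairing with B, the quotient by Z embeds in the dual of B. Together
  -- with Z ∩ B = 0 this gives Z + B full rank.
  have h1 : Module.finrank ℤ ((E → ℤ) ⧸ Z) ≤ Module.finrank ℤ B := by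
    rw [← Module.finrank_linearMap_self ℤ ℤ B]
    refine LinearMap.finrank_le_finrank_of_injective (f := Z.liftQ pair hker.le) ?_
    rw [← LinearMap.ker_eq_bot, Submodule.ker_liftQ, hker]
    simp
  have h2 := Submodule.finrank_quotient_add_finrank Z
  have h3 : Module.finrank ℤ (Z × B) ≤ Module.finrank ℤ (Z ⊔ B : Submodule ℤ (E → ℤ)) := by
    refine LinearMap.finrank_le_finrank_of_injective
      (f := (Submodule.inclusion le_sup_left).coprod (Submodule.inclusion le_sup_right)) ?_
    rw [injective_iff_map_eq_zero]
    rintro ⟨⟨z, hz⟩, ⟨b, hb⟩⟩ h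
    have h' : z + b = 0 := by simpa [Subtype.ext_iff] using h
    have hzb : z = -b := eq_neg_of_add_eq_zero_left h'
    have hz0 : z = 0 := D.eq_zero_of_mem_cycleSpace_of_mem_bondSpace hz (hzb ▸ neg_mem hb)
    have hb0 : b = 0 := by simpa [hz0] using h'
    simp [hz0, hb0]
  rw [Module.finrank_prod] at h3
  omega

end OrientedMultigraph

/-! ### Reduction modulo two and lifting of cycles and bonds. -/

/-- Reduction modulo two of an integral vector. -/
def reduceModTwo (I : Type*) : (I → ℤ) →+ (I → ZMod 2) :=
  (Int.castAddHom (ZMod 2)).compLeft I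

@[simp]
theorem reduceModTwo_apply {I : Type*} (x : I → ℤ) (i : I) :
    reduceModTwo I x i = (x i : ZMod 2) := rfl

theorem reduceModTwo_surjective (I : Type*) : Function.Surjective (reduceModTwo I) := fun x =>
  ⟨fun i => (x i).val, funext fun i => by simp⟩

theorem reduceModTwo_eq_zero_iff {I : Type*} {x : I → ℤ} :
    reduceModTwo I x = 0 ↔ ∃ y, x = (2 : ℤ) • y := by
  constructor
  · intro h
    have h' : ∀ i, ∃ y, x i = 2 * y := fun i =>
      (ZMod.intCast_zmod_eq_zero_iff_dvd (x i) 2).mp (congrFun h i)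
    choose y hy using h'
    exact ⟨y, funext hy⟩
  · rintro ⟨y, rfl⟩
    ext i
    have : (2 : ZMod 2) = 0 := rfl
    simp [this]

theorem reduceModTwo_dotProduct {I : Type*} [Fintype I] (x y : I → ℤ) :
    reduceModTwo I x ⬝ᵥ reduceModTwo I y = ((x ⬝ᵥ y : ℤ) : ZMod 2) := by
  simp [dotProduct]

namespace OrientedMultigraph

variable {V : Type u} {E : Type v} (D : OrientedMultigraph V E)

theorem reduceModTwo_mem_bondSpace {x : E → ℤ} (hx : x ∈ D.bondSpace ℤ) :
    reduceModTwo E x ∈ D.bondSpace (ZMod 2) := by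
  rw [mem_bondSpace] at hx ⊢
  obtain ⟨w, hw⟩ := hx
  exact ⟨fun v => w v, fun e => by simp [← hw e]⟩

theorem exists_mem_bondSpace_reduceModTwo_eq {x : E → ZMod 2} (hx : x ∈ D.bondSpace (ZMod 2)) :
    ∃ y ∈ D.bondSpace ℤ, reduceModTwo E y = x := by
  obtain ⟨w, rfl⟩ := hx
  obtain ⟨w, rfl⟩ := reduceModTwo_surjective V w
  exact ⟨D.coboundary ℤ w, ⟨w, rfl⟩, funext fun e => by simp [coboundary_apply]⟩

variable [Fintype E]

theorem boundary_reduceModTwo (x : E → ℤ) :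
    D.boundary (ZMod 2) (reduceModTwo E x) = reduceModTwo V (D.boundary ℤ x) := by
  classical
  ext v
  simp [boundary_apply_eq_sum, coboundary_apply, Pi.single_apply]

theorem reduceModTwo_mem_cycleSpace {x : E → ℤ} (hx : x ∈ D.cycleSpace ℤ) :
    reduceModTwo E x ∈ D.cycleSpace (ZMod 2) := by
  rw [cycleSpace, LinearMap.mem_ker] at hx ⊢
  rw [boundary_reduceModTwo, hx, map_zero]

/-- An arbitrary lift x has boundary 2u. Since ∂ has torsion-free cokernel, u = ∂y, and x - 2y is an
integral cycle with the same reduction. -/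
theorem exists_mem_cycleSpace_reduceModTwo_eq [Finite V] {x : E → ZMod 2}
    (hx : x ∈ D.cycleSpace (ZMod 2)) : ∃ y ∈ D.cycleSpace ℤ, reduceModTwo E y = x := by
  obtain ⟨x, rfl⟩ := reduceModTwo_surjective E x
  rw [cycleSpace, LinearMap.mem_ker, boundary_reduceModTwo, reduceModTwo_eq_zero_iff] at hx
  obtain ⟨u, hu⟩ := hx
  obtain ⟨y, rfl⟩ := D.mem_range_boundary_of_two_smul ⟨x, hu⟩
  refine ⟨x - (2 : ℤ) • y, ?_, ?_⟩
  · rw [cycleSpace, LinearMap.mem_ker, map_sub, map_smul, hu, sub_self]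
  · rw [map_sub, reduceModTwo_eq_zero_iff.mpr ⟨y, rfl⟩, sub_zero]

end OrientedMultigraph

/-! ### Kernel and cokernel of a half-isomorphism. -/

/-- A homomorphism between the critical groups of two multigraphs `D'` and `D` is a
*half-isomorphism* when it is induced by a linear map `f` of edge lattices with an adjoint `g` such
that `f` and `g` respect bonds, and are inverse to each other up to the factor two. -/
structure HalfIsomorphism {V' V E' E : Type*} [Fintype E'] [Fintype E]
    (D' : OrientedMultigraph V' E') (D : OrientedMultigraph V E)
    (f : (E' → ℤ) →ₗ[ℤ] (E → ℤ)) (g : (E → ℤ) →ₗ[ℤ] (E' → ℤ)) : Prop where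
  adjoint : ∀ x y, x ⬝ᵥ f y = g x ⬝ᵥ y
  map_bond : ∀ y ∈ D'.bondSpace ℤ, f y ∈ D.bondSpace ℤ
  adjoint_map_bond : ∀ x ∈ D.bondSpace ℤ, g x ∈ D'.bondSpace ℤ
  comp_adjoint : ∀ x, f (g x) = (2 : ℤ) • x
  adjoint_comp_sub_mem : ∀ y, g (f y) - (2 : ℤ) • y ∈ D'.bondSpace ℤ
  adjoint_comp_of_mem_cycleSpace : ∀ y ∈ D'.cycleSpace ℤ, g (f y) = (2 : ℤ) • y

namespace HalfIsomorphism

variable {V' V E' E : Type*} [Fintype E'] [Fintype E]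
  {D' : OrientedMultigraph V' E'} {D : OrientedMultigraph V E}
  {f : (E' → ℤ) →ₗ[ℤ] (E → ℤ)} {g : (E → ℤ) →ₗ[ℤ] (E' → ℤ)}

variable (H : HalfIsomorphism D' D f g)
include H

theorem two_smul_coker_eq_zero {K' : Type*} [AddCommGroup K'] {π : (E' → ℤ) →+ K'}
    {F : K' →+ D.CriticalGroup} (hF : ∀ y, F (π y) = D.toCriticalGroup (f y))
    (c : D.CriticalGroup ⧸ F.range) : 2 • c = 0 := by
  obtain ⟨k, rfl⟩ := QuotientAddGroup.mk'_surjective _ c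
  obtain ⟨x, rfl⟩ := Submodule.mkQ_surjective _ k
  rw [← map_nsmul]
  refine (QuotientAddGroup.eq_zero_iff (N := F.range) _).mpr ⟨π (g x), ?_⟩
  rw [hF, H.comp_adjoint, map_smul, ← natCast_zsmul]
  rfl

variable [Finite V]

/-- The cokernel of the homomorphism induced by `f` is isomorphic to the space of those bicycles
which `g` annihilates. -/
theorem nonempty_coker_equiv {K' : Type*} [AddCommGroup K'] {π : (E' → ℤ) →+ K'}
    (hπ : Function.Surjective π)
    {F : K' →+ D.CriticalGroup} (hF : ∀ y, F (π y) = D.toCriticalGroup (f y))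
    {A : Submodule (ZMod 2) (E → ZMod 2)}
    (hA : ∀ x, reduceModTwo E x ∈ A ↔ reduceModTwo E' (g x) = 0) :
    Nonempty ((D.CriticalGroup ⧸ F.range) ≃+
      (D.bicycleSpace ⊓ A : Submodule (ZMod 2) (E → ZMod 2))) := by
  set C := D.bicycleSpace ⊓ A with hCdef
  -- The cokernel and the dual of the bicycle space `C` are both quotients of ℤE, through `q` and
  -- `p`, by this same subgroup.
  let M : AddSubgroup (E → ℤ) :=
    (D.cycleSpace ℤ ⊔ D.bondSpace ℤ ⊔ LinearMap.range f).toAddSubgroup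
  let q : (E → ℤ) →+ D.CriticalGroup ⧸ F.range :=
    (QuotientAddGroup.mk' F.range).comp D.toCriticalGroup.toAddMonoidHom
  have hq : Function.Surjective q :=
    (QuotientAddGroup.mk'_surjective _).comp (Submodule.mkQ_surjective _)
  have hqM : q.ker = M := by
    ext x
    have h1 : x ∈ q.ker ↔ D.toCriticalGroup x ∈ F.range :=
      QuotientAddGroup.eq_zero_iff (N := F.range) (D.toCriticalGroup x)
    have h2 : x ∈ M ↔ x ∈ D.cycleSpace ℤ ⊔ D.bondSpace ℤ ⊔ LinearMap.range f := Iff.rfl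
    rw [h1, h2]
    constructor
    · rintro ⟨k, hk⟩
      obtain ⟨y, rfl⟩ := hπ k
      rw [hF] at hk
      have h3 : x - f y ∈ D.cycleSpace ℤ ⊔ D.bondSpace ℤ :=
        (Submodule.Quotient.eq _).mp hk.symm
      rw [← sub_add_cancel x (f y)]
      exact Submodule.add_mem_sup h3 ⟨y, rfl⟩
    · intro hx
      obtain ⟨l, hl, _, ⟨y, rfl⟩, rfl⟩ := Submodule.mem_sup.mp hx
      refine ⟨π y, ?_⟩
      rw [hF, map_add]
      have : D.toCriticalGroup l = 0 := (Submodule.Quotient.mk_eq_zero _).mpr hl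
      rw [this, zero_add]
  let p : (E → ℤ) →+ Module.Dual (ZMod 2) C :=
    ((Submodule.dualRestrict C).comp (dotProductBilin (ZMod 2) (ZMod 2))).toAddMonoidHom.comp
      (reduceModTwo E)
  have hpapply : ∀ x (a : C), p x a = reduceModTwo E x ⬝ᵥ (a : E → ZMod 2) := fun x a => rfl
  have hp : Function.Surjective p := by
    classical
    intro φ
    obtain ⟨Φ, rfl⟩ := Subspace.dualRestrict_surjective (W := C) φ
    obtain ⟨x, hx⟩ := reduceModTwo_surjective E fun e => Φ (Pi.single e 1)
    refine ⟨x, LinearMap.ext fun a => ?_⟩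
    rw [hpapply, hx, Submodule.dualRestrict_apply,
      OrientedMultigraph.linearForm_eq_dotProduct Φ]
  have hpM : p.ker = M := by
    ext x
    have h2 : x ∈ M ↔ x ∈ D.cycleSpace ℤ ⊔ D.bondSpace ℤ ⊔ LinearMap.range f := Iff.rfl
    rw [AddMonoidHom.mem_ker]
    constructor
    · intro hx
      by_contra hxM
      -- Because f∘g = 2, `M` contains 2ℤE, so membership in `M` can be tested mod 2. A functional
      -- `a` that separates `x` from `M` lies in `C`, contradicting `p x = 0`.
      let W : Submodule (ZMod 2) (E → ZMod 2) :=
        AddSubgroup.toZModSubmodule 2 (M.map (reduceModTwo E))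
      have hxW : reduceModTwo E x ∉ W := by
        rintro ⟨m, hm, hmx⟩
        obtain ⟨y, hy⟩ := reduceModTwo_eq_zero_iff.mp
          (show reduceModTwo E (x - m) = 0 by rw [map_sub, hmx, sub_self])
        refine hxM ?_
        rw [← sub_add_cancel x m, hy, ← H.comp_adjoint]
        exact add_mem (Submodule.mem_sup_right ⟨_, rfl⟩) hm
      obtain ⟨a, haW, hax⟩ := OrientedMultigraph.exists_dotProduct_ne_zero hxW
      have hmem : ∀ m ∈ D.cycleSpace ℤ ⊔ D.bondSpace ℤ ⊔ LinearMap.range f,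
          a ⬝ᵥ reduceModTwo E m = 0 := fun m hm => haW _ ⟨m, hm, rfl⟩
      have haC : a ∈ C := by
        refine ⟨⟨?_, ?_⟩, ?_⟩
        · refine D.mem_cycleSpace_iff.mpr fun b hb => ?_
          obtain ⟨b, hb', rfl⟩ := D.exists_mem_bondSpace_reduceModTwo_eq hb
          exact hmem b (Submodule.mem_sup_left (Submodule.mem_sup_right hb'))
        · refine D.mem_bondSpace_iff.mpr fun z hz => ?_
          obtain ⟨z, hz', rfl⟩ := D.exists_mem_cycleSpace_reduceModTwo_eq hz
          rw [dotProduct_comm]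
          exact hmem z (Submodule.mem_sup_left (Submodule.mem_sup_left hz'))
        · obtain ⟨a, rfl⟩ := reduceModTwo_surjective E a
          refine (hA a).mpr ?_
          refine dotProduct_eq_zero _ fun y => ?_
          obtain ⟨y, rfl⟩ := reduceModTwo_surjective E' y
          have := hmem (f y) (Submodule.mem_sup_right ⟨y, rfl⟩)
          rwa [reduceModTwo_dotProduct, H.adjoint, ← reduceModTwo_dotProduct] at this
      have := LinearMap.congr_fun hx ⟨a, haC⟩
      rw [hpapply, dotProduct_comm] at this
      exact hax this
    · intro hx
      obtain ⟨l, hl, _, ⟨y, rfl⟩, rfl⟩ := Submodule.mem_sup.mp (h2.mp hx)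
      obtain ⟨z, hz, b, hb, rfl⟩ := Submodule.mem_sup.mp hl
      refine LinearMap.ext fun ⟨a, ⟨haZ, haB⟩, haA⟩ => ?_
      have h3 : reduceModTwo E z ⬝ᵥ a = 0 :=
        D.mem_cycleSpace_iff.mp (D.reduceModTwo_mem_cycleSpace hz) a haB
      have h4 : reduceModTwo E b ⬝ᵥ a = 0 := by
        rw [dotProduct_comm]
        exact D.mem_cycleSpace_iff.mp haZ _ (D.reduceModTwo_mem_bondSpace hb)
      have h5 : reduceModTwo E (f y) ⬝ᵥ a = 0 := by
        obtain ⟨a, rfl⟩ := reduceModTwo_surjective E a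
        rw [dotProduct_comm, reduceModTwo_dotProduct, H.adjoint, ← reduceModTwo_dotProduct,
          (hA a).mp haA, zero_dotProduct]
      rw [hpapply, map_add, map_add, add_dotProduct, add_dotProduct, h3, h4, h5]
      simp
  obtain ⟨e⟩ : Nonempty (Module.Dual (ZMod 2) C ≃ₗ[ZMod 2] C) :=
    FiniteDimensional.nonempty_linearEquiv_of_finrank_eq Subspace.dual_finrank_eq
  exact ⟨((QuotientAddGroup.quotientKerEquivOfSurjective q hq).symm.trans
    ((QuotientAddGroup.quotientAddEquivOfEq (hqM.trans hpM.symm)).trans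
      (QuotientAddGroup.quotientKerEquivOfSurjective p hp))).trans e.toAddEquiv⟩

variable [Finite V']

/-- Cycles are orthogonal to bonds, and the adjoint preserves bonds. -/
theorem map_cycle {y : E' → ℤ} (hy : y ∈ D'.cycleSpace ℤ) : f y ∈ D.cycleSpace ℤ := by
  rw [OrientedMultigraph.mem_cycleSpace_iff] at hy ⊢
  intro b hb
  rw [dotProduct_comm, H.adjoint, dotProduct_comm]
  exact hy _ (H.adjoint_map_bond b hb)

theorem adjoint_map_cycle {x : E → ℤ} (hx : x ∈ D.cycleSpace ℤ) : g x ∈ D'.cycleSpace ℤ := by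
  rw [OrientedMultigraph.mem_cycleSpace_iff] at hx ⊢
  intro b hb
  rw [← H.adjoint]
  exact hx _ (H.map_bond b hb)

theorem map_mem_sup {y : E' → ℤ} (hy : y ∈ D'.cycleSpace ℤ ⊔ D'.bondSpace ℤ) :
    f y ∈ D.cycleSpace ℤ ⊔ D.bondSpace ℤ := by
  obtain ⟨z, hz, b, hb, rfl⟩ := Submodule.mem_sup.mp hy
  rw [map_add]
  exact Submodule.add_mem_sup (H.map_cycle hz) (H.map_bond b hb)

theorem adjoint_map_mem_sup {x : E → ℤ} (hx : x ∈ D.cycleSpace ℤ ⊔ D.bondSpace ℤ) :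
    g x ∈ D'.cycleSpace ℤ ⊔ D'.bondSpace ℤ := by
  obtain ⟨z, hz, b, hb, rfl⟩ := Submodule.mem_sup.mp hx
  rw [map_add]
  exact Submodule.add_mem_sup (H.adjoint_map_cycle hz) (H.adjoint_map_bond b hb)

theorem two_smul_mem_of_map_mem {y : E' → ℤ}
    (hy : f y ∈ D.cycleSpace ℤ ⊔ D.bondSpace ℤ) :
    (2 : ℤ) • y ∈ D'.cycleSpace ℤ ⊔ D'.bondSpace ℤ := by
  have h := sub_mem (H.adjoint_map_mem_sup hy)
    (Submodule.mem_sup_right (S := D'.cycleSpace ℤ) (H.adjoint_comp_sub_mem y))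
  rwa [sub_sub_cancel] at h

/-- If `f y = z + b` with a cycle `z` and a bond `b`, then `y` represents zero exactly when `g z` is
even. -/
theorem mem_sup_iff {y : E' → ℤ} {z : E → ℤ} (hz : z ∈ D.cycleSpace ℤ)
    (hyz : f y - z ∈ D.bondSpace ℤ) :
    y ∈ D'.cycleSpace ℤ ⊔ D'.bondSpace ℤ ↔ reduceModTwo E' (g z) = 0 := by
  rw [reduceModTwo_eq_zero_iff]
  constructor
  · intro hy
    obtain ⟨z', hz', b', hb', rfl⟩ := Submodule.mem_sup.mp hy
    have h1 : f z' - z ∈ D.bondSpace ℤ := by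
      have h := sub_mem hyz (H.map_bond b' hb')
      rwa [map_add, sub_right_comm, add_sub_cancel_right] at h
    -- `f z'` and `z` are cycles that differ by a bond, and Z ∩ B = 0 over ℤ.
    have h2 := D.eq_zero_of_mem_cycleSpace_of_mem_bondSpace (sub_mem (H.map_cycle hz') hz) h1
    refine ⟨z', ?_⟩
    rw [← sub_eq_zero.mp h2, H.adjoint_comp_of_mem_cycleSpace z' hz']
  · rintro ⟨z', hz'⟩
    have h1 : z' ∈ D'.cycleSpace ℤ :=
      D'.mem_cycleSpace_of_two_smul (hz' ▸ H.adjoint_map_cycle hz)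
    have h2 : y - z' ∈ D'.bondSpace ℤ := by
      -- 2(y - z') = g(f y - z) - (g(f y) - 2y), a difference of bonds.
      refine D'.mem_bondSpace_of_two_smul ?_
      have h := sub_mem (H.adjoint_map_bond _ hyz) (H.adjoint_comp_sub_mem y)
      rw [map_sub, hz'] at h
      convert h using 1
      rw [smul_sub]
      abel
    rw [← add_sub_cancel z' y]
    exact Submodule.add_mem_sup h1 h2

/-- This gives surjectivity onto the bicycles in `nonempty_ker_equiv`. Lift x to an integral cycle c
and an integral bond b, and halve: f c = 2z, f b = 2t, c - b = 2y. Then f y - z = -t is a bond, and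
2 g z = g(f c) = 2c, so g z = c reduces to x. -/
theorem exists_cycle_of_mem_bicycleSpace {x : E' → ZMod 2} (hx : x ∈ D'.bicycleSpace)
    (hfx : ∀ y, reduceModTwo E' y = x → reduceModTwo E (f y) = 0) :
    ∃ z ∈ D.cycleSpace ℤ, ∃ y, f y - z ∈ D.bondSpace ℤ ∧ reduceModTwo E' (g z) = x := by
  obtain ⟨c, hc, hcx⟩ := D'.exists_mem_cycleSpace_reduceModTwo_eq hx.1
  obtain ⟨b, hb, hbx⟩ := D'.exists_mem_bondSpace_reduceModTwo_eq hx.2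
  obtain ⟨z, hz⟩ := reduceModTwo_eq_zero_iff.mp (hfx c hcx)
  obtain ⟨t, ht⟩ := reduceModTwo_eq_zero_iff.mp (hfx b hbx)
  obtain ⟨y, hy⟩ := reduceModTwo_eq_zero_iff.mp
    (show reduceModTwo E' (c - b) = 0 by rw [map_sub, hcx, hbx, sub_self])
  have hzy : f y - z = -t := by
    refine smul_right_injective (E → ℤ) (two_ne_zero (α := ℤ)) ?_
    change (2 : ℤ) • (f y - z) = (2 : ℤ) • -t
    rw [smul_sub, ← map_smul, ← hy, map_sub, ← hz, smul_neg, ← ht]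
    abel
  have hgz : g z = c := by
    refine smul_right_injective (E' → ℤ) (two_ne_zero (α := ℤ)) ?_
    change (2 : ℤ) • g z = (2 : ℤ) • c
    rw [← map_smul, ← hz, H.adjoint_comp_of_mem_cycleSpace c hc]
  refine ⟨z, D.mem_cycleSpace_of_two_smul (hz ▸ H.map_cycle hc), y, ?_, by rw [hgz, hcx]⟩
  rw [hzy]
  exact neg_mem (D.mem_bondSpace_of_two_smul (ht ▸ H.map_bond b hb))

/-- The kernel of the homomorphism induced by `f` is isomorphic to the space of those bicycles which
`f` annihilates. -/
theorem nonempty_ker_equiv {K' : Type*} [AddCommGroup K'] {π : (E' → ℤ) →+ K'}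
    (hπ : Function.Surjective π)
    (hker : ∀ y, π y = 0 ↔ y ∈ D'.cycleSpace ℤ ⊔ D'.bondSpace ℤ)
    {F : K' →+ D.CriticalGroup} (hF : ∀ y, F (π y) = D.toCriticalGroup (f y))
    {C : Submodule (ZMod 2) (E' → ZMod 2)}
    (hC : ∀ y, reduceModTwo E' y ∈ C ↔ reduceModTwo E (f y) = 0) :
    Nonempty (F.ker ≃+ (D'.bicycleSpace ⊓ C : Submodule (ZMod 2) (E' → ZMod 2))) := by
  -- The cycle `z` belonging to `y` depends on the representative, so both groups are presented as
  -- quotients of the group of pairs `(z, y)`: `α` takes the class of `y`, `β` takes `g z` mod 2,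
  -- and `mem_sup_iff` says that their kernels agree.
  let T : AddSubgroup ((E → ℤ) × (E' → ℤ)) :=
    { carrier := {p | p.1 ∈ D.cycleSpace ℤ ∧ f p.2 - p.1 ∈ D.bondSpace ℤ}
      zero_mem' := by simp
      add_mem' := by
        rintro p q ⟨h1, h2⟩ ⟨h3, h4⟩
        refine ⟨add_mem h1 h3, ?_⟩
        have := add_mem h2 h4
        simp only [Prod.snd_add, Prod.fst_add, map_add]
        rwa [add_sub_add_comm]
      neg_mem' := by
        rintro p ⟨h1, h2⟩
        refine ⟨neg_mem h1, ?_⟩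
        have := neg_mem h2
        simp only [Prod.snd_neg, Prod.fst_neg, map_neg]
        rwa [neg_sub_neg, ← neg_sub] }
  have hmemker : ∀ y, π y ∈ F.ker ↔ f y ∈ D.cycleSpace ℤ ⊔ D.bondSpace ℤ := fun y => by
    rw [AddMonoidHom.mem_ker, hF]
    exact Submodule.Quotient.mk_eq_zero _
  let α : T →+ F.ker :=
    ((π.comp (AddMonoidHom.snd _ _)).comp T.subtype).codRestrict F.ker fun p => by
      refine (hmemker _).mpr ?_
      have := Submodule.add_mem_sup p.2.1 p.2.2
      rwa [add_sub_cancel] at this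
  let β : T →+ (D'.bicycleSpace ⊓ C : Submodule (ZMod 2) (E' → ZMod 2)) :=
    (((reduceModTwo E').comp (g.toAddMonoidHom.comp (AddMonoidHom.fst _ _))).comp
      T.subtype).codRestrict (D'.bicycleSpace ⊓ C).toAddSubgroup fun p => by
      obtain ⟨⟨z, y⟩, hz, hy⟩ := p
      change reduceModTwo E' (g z) ∈ D'.bicycleSpace ⊓ C
      refine ⟨⟨D'.reduceModTwo_mem_cycleSpace (H.adjoint_map_cycle hz), ?_⟩, ?_⟩
      · have h := sub_mem (H.adjoint_comp_sub_mem y) (H.adjoint_map_bond _ hy)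
        have h2 : g (f y) - (2 : ℤ) • y - g (f y - z) = g z - (2 : ℤ) • y := by
          rw [map_sub]
          abel
        have h' := D'.reduceModTwo_mem_bondSpace (h2 ▸ h)
        rwa [map_sub, reduceModTwo_eq_zero_iff.mpr ⟨y, rfl⟩, sub_zero] at h'
      · refine (hC _).mpr ?_
        rw [H.comp_adjoint]
        exact reduceModTwo_eq_zero_iff.mpr ⟨z, rfl⟩
  have hα : Function.Surjective α := by
    rintro ⟨k, hk⟩
    obtain ⟨y, rfl⟩ := hπ k
    obtain ⟨z, hz, b, hb, hzb⟩ := Submodule.mem_sup.mp ((hmemker y).mp hk)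
    refine ⟨⟨(z, y), hz, ?_⟩, rfl⟩
    change f y - z ∈ _
    rwa [← hzb, add_sub_cancel_left]
  have hβ : Function.Surjective β := by
    rintro ⟨x, hx, hxC⟩
    obtain ⟨z, hz, y, hy, hgz⟩ := H.exists_cycle_of_mem_bicycleSpace hx
      (by rintro y rfl; exact (hC y).mp hxC)
    exact ⟨⟨(z, y), hz, hy⟩, Subtype.ext hgz⟩
  have hαβ : α.ker = β.ker := by
    ext ⟨⟨z, y⟩, hz, hy⟩
    rw [AddMonoidHom.mem_ker, AddMonoidHom.mem_ker, Subtype.ext_iff, Subtype.ext_iff]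
    exact (hker y).trans (H.mem_sup_iff hz hy)
  exact ⟨(QuotientAddGroup.quotientKerEquivOfSurjective α hα).symm.trans
    ((QuotientAddGroup.quotientAddEquivOfEq hαβ).trans
      (QuotientAddGroup.quotientKerEquivOfSurjective β hβ))⟩

theorem two_smul_eq_zero_of_mem_ker {K' : Type*} [AddCommGroup K'] {π : (E' → ℤ) →+ K'}
    (hπ : Function.Surjective π)
    (hker : ∀ y, π y = 0 ↔ y ∈ D'.cycleSpace ℤ ⊔ D'.bondSpace ℤ)
    {F : K' →+ D.CriticalGroup} (hF : ∀ y, F (π y) = D.toCriticalGroup (f y))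
    {k : K'} (hk : k ∈ F.ker) : 2 • k = 0 := by
  obtain ⟨y, rfl⟩ := hπ k
  rw [AddMonoidHom.mem_ker, hF] at hk
  rw [← map_nsmul, hker, ← natCast_zsmul]
  exact H.two_smul_mem_of_map_mem ((Submodule.Quotient.mk_eq_zero _).mp hk)

end HalfIsomorphism

/-! ### Disjoint unions. -/

namespace OrientedMultigraph

variable {V : Type u} {E : Type v} {V' E' : Type*}

theorem mem_bondSpace_disjointUnion {D : OrientedMultigraph V E} {D' : OrientedMultigraph V' E'}
    {R : Type*} [CommRing R] {x : E ⊕ E' → R} :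
    x ∈ (D.disjointUnion D').bondSpace R ↔
      x ∘ Sum.inl ∈ D.bondSpace R ∧ x ∘ Sum.inr ∈ D'.bondSpace R := by
  simp only [mem_bondSpace]
  constructor
  · rintro ⟨w, hw⟩
    exact ⟨⟨w ∘ Sum.inl, fun e => hw (.inl e)⟩, ⟨w ∘ Sum.inr, fun e => hw (.inr e)⟩⟩
  · rintro ⟨⟨w, hw⟩, ⟨w', hw'⟩⟩
    exact ⟨Sum.elim w w', Sum.rec hw hw'⟩

theorem mem_cycleSpace_disjointUnion [Finite V] [Finite V'] [Fintype E] [Fintype E']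
    {D : OrientedMultigraph V E} {D' : OrientedMultigraph V' E'}
    {R : Type*} [CommRing R] {x : E ⊕ E' → R} :
    x ∈ (D.disjointUnion D').cycleSpace R ↔
      x ∘ Sum.inl ∈ D.cycleSpace R ∧ x ∘ Sum.inr ∈ D'.cycleSpace R := by
  simp only [mem_cycleSpace_iff', Fintype.sum_sum_type]
  constructor
  · intro h
    refine ⟨fun w => ?_, fun w => ?_⟩
    · simpa [disjointUnion] using h (Sum.elim w 0)
    · simpa [disjointUnion] using h (Sum.elim 0 w)
  · rintro ⟨h, h'⟩ w
    have := congrArg₂ (· + ·) (h (w ∘ Sum.inl)) (h' (w ∘ Sum.inr))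
    rwa [add_zero] at this

theorem mem_cycleSpace_sup_bondSpace_disjointUnion [Finite V] [Finite V'] [Fintype E] [Fintype E']
    {D : OrientedMultigraph V E} {D' : OrientedMultigraph V' E'} {x : E ⊕ E' → ℤ} :
    x ∈ (D.disjointUnion D').cycleSpace ℤ ⊔ (D.disjointUnion D').bondSpace ℤ ↔
      x ∘ Sum.inl ∈ D.cycleSpace ℤ ⊔ D.bondSpace ℤ ∧
        x ∘ Sum.inr ∈ D'.cycleSpace ℤ ⊔ D'.bondSpace ℤ := by
  constructor
  · intro h
    obtain ⟨z, hz, b, hb, rfl⟩ := Submodule.mem_sup.mp h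
    rw [mem_cycleSpace_disjointUnion] at hz
    rw [mem_bondSpace_disjointUnion] at hb
    exact ⟨Submodule.add_mem_sup hz.1 hb.1, Submodule.add_mem_sup hz.2 hb.2⟩
  · rintro ⟨h, h'⟩
    obtain ⟨z, hz, b, hb, hzb⟩ := Submodule.mem_sup.mp h
    obtain ⟨z', hz', b', hb', hzb'⟩ := Submodule.mem_sup.mp h'
    have hx : x = Sum.elim z z' + Sum.elim b b' := by
      ext (e | e)
      · exact (congrFun hzb e).symm
      · exact (congrFun hzb' e).symm
    rw [hx]
    exact Submodule.add_mem_sup (mem_cycleSpace_disjointUnion.mpr ⟨hz, hz'⟩)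
      (mem_bondSpace_disjointUnion.mpr ⟨hb, hb'⟩)

end OrientedMultigraph

/-! ### The map `f` and its transpose in coordinates. -/

namespace ReflectiveSymmetry

variable {V : Type u} {E : Type v} {G : Multigraph V E} (S : ReflectiveSymmetry G)

/-- The reflection as a bijection from the left to the right edges. -/
def leftEquivRight : S.LeftEdge ≃ S.RightEdge where
  toFun e := ⟨S.φE e, by rw [S.sideE_φE, e.2]; rfl⟩
  invFun e := ⟨S.φE e, by rw [S.sideE_φE, e.2]⟩
  left_inv e := Subtype.ext (S.φE_involutive e)
  right_inv e := Subtype.ext (S.φE_involutive e)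

@[simp]
theorem coe_leftEquivRight (e : S.LeftEdge) : (S.leftEquivRight e : E) = S.φE e := rfl

@[simp]
theorem φE_φE (e : E) : S.φE (S.φE e) = e := S.φE_involutive e

@[simp]
theorem φV_φV (v : V) : S.φV (S.φV v) = v := S.φV_involutive v

theorem φE_axis (a : S.AxisEdge) : S.φE a = a := (S.sideE_eq_zero_iff a).mp a.2

theorem edge_cases {P : E → Prop} (left : ∀ l : S.LeftEdge, P l) (right : ∀ l : S.LeftEdge, P (S.φE l))
    (axis : ∀ a : S.AxisEdge, P a) (e : E) : P e := by
  rcases h : S.sideE e with _ | _ | _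
  · exact axis ⟨e, h⟩
  · exact left ⟨e, h⟩
  · have := right (S.leftEquivRight.symm ⟨e, h⟩)
    rwa [← coe_leftEquivRight, Equiv.apply_symm_apply] at this

theorem sum_edges [Fintype E] {M : Type*} [AddCommMonoid M] (F : E → M) :
    ∑ e, F e = ∑ l : S.LeftEdge, F l + ∑ l : S.LeftEdge, F (S.φE l) + ∑ a : S.AxisEdge, F a := by
  let i : (S.LeftEdge ⊕ S.LeftEdge) ⊕ S.AxisEdge → E :=
    Sum.elim (Sum.elim (fun l => l) fun l => S.φE l) fun a => a
  have hi : Function.Bijective i := by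
    constructor
    · have hs : ∀ l : S.LeftEdge, S.sideE (S.φE l) = 1 := fun l => (S.leftEquivRight l).2
      rintro ((l | l) | a) ((l' | l') | a') h <;> simp only [i, Sum.elim_inl, Sum.elim_inr] at h
      · rw [Subtype.ext h]
      · have := hs l'
        rw [← h, l.2] at this
        cases this
      · have := a'.2
        rw [← h, l.2] at this
        cases this
      · have := hs l
        rw [h, l'.2] at this
        cases this
      · rw [Subtype.ext (S.φE_involutive.injective h)]
      · have := hs l
        rw [h, a'.2] at this
        cases this
      · have := a.2
        rw [h, l'.2] at this
        cases this
      · have := hs l'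
        rw [← h, a.2] at this
        cases this
      · rw [Subtype.ext h]
    · exact S.edge_cases (fun l => ⟨.inl (.inl l), rfl⟩) (fun l => ⟨.inl (.inr l), rfl⟩)
        fun a => ⟨.inr a, rfl⟩
  rw [← Fintype.sum_bijective i hi (fun p => F (i p)) F fun _ => rfl]
  simp [i]

theorem φE_left_ne_left (l l' : S.LeftEdge) : S.φE l ≠ l' := fun h => by
  have := S.sideE_φE l
  rw [h, l.2, l'.2] at this
  cases this

theorem φE_left_ne_axis (l : S.LeftEdge) (a : S.AxisEdge) : S.φE l ≠ a := fun h => by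
  have := S.sideE_φE l
  rw [h, l.2, a.2] at this
  cases this

theorem left_ne_axis (l : S.LeftEdge) (a : S.AxisEdge) : (l : E) ≠ a := fun h => by
  have := l.2
  rw [h, a.2] at this
  cases this

section f

variable [Fintype E] (x : S.PlusEdge → ℤ) (y : S.MinusEdge → ℤ)

theorem dotProduct_f (z : E → ℤ) : z ⬝ᵥ S.f (x, y) =
    ∑ l : S.LeftEdge, x (.inl l) * (z l + z (S.φE l)) +
      ∑ a : S.AxisEdge, (x (.inr (a, false)) + x (.inr (a, true))) * z a +
      ∑ l : S.LeftEdge, y (S.leftEquivRight l) * (z (S.φE l) - z l) := by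
  have h := Equiv.sum_comp S.leftEquivRight fun r => y r * (z r - z (S.φE r))
  simp only [coe_leftEquivRight, φE_φE] at h
  rw [h]
  simp only [f, LinearMap.coprod_apply, Fintype.linearCombination_apply, dotProduct_add,
    dotProduct_sum, dotProduct_smul, Fintype.sum_sum_type, Sum.elim_inl, Sum.elim_inr,
    dotProduct_sub, dotProduct_single, mul_one, smul_eq_mul, Fintype.sum_prod_type,
    Fintype.sum_bool]
  refine congrArg₂ (· + ·) (congrArg₂ (· + ·) rfl ?_) rfl
  exact Finset.sum_congr rfl fun _ _ => by ring

theorem f_apply [DecidableEq E] (e : E) : S.f (x, y) e =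
    ∑ l : S.LeftEdge, x (.inl l) *
        ((Pi.single e 1 : E → ℤ) l + (Pi.single e 1 : E → ℤ) (S.φE l)) +
      ∑ a : S.AxisEdge, (x (.inr (a, false)) + x (.inr (a, true))) * (Pi.single e 1 : E → ℤ) a +
      ∑ l : S.LeftEdge, y (S.leftEquivRight l) *
        ((Pi.single e 1 : E → ℤ) (S.φE l) - (Pi.single e 1 : E → ℤ) l) := by
  have := S.dotProduct_f x y (Pi.single e 1)
  rwa [single_dotProduct, one_mul] at this

theorem f_left (l : S.LeftEdge) : S.f (x, y) l = x (.inl l) - y (S.leftEquivRight l) := by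
  classical
  rw [f_apply]
  simp [Pi.single_apply, Subtype.coe_inj, φE_left_ne_left, (S.left_ne_axis _ _).symm,
    sub_eq_add_neg]

theorem f_right (l : S.LeftEdge) :
    S.f (x, y) (S.φE l) = x (.inl l) + y (S.leftEquivRight l) := by
  classical
  rw [f_apply]
  simp [Pi.single_apply, Subtype.coe_inj, (S.φE_left_ne_left _ _).symm,
    (S.φE_left_ne_axis _ _).symm, S.φE_involutive.injective.eq_iff]

theorem f_axis (a : S.AxisEdge) :
    S.f (x, y) a = x (.inr (a, false)) + x (.inr (a, true)) := by
  classical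
  rw [f_apply]
  simp [Pi.single_apply, Subtype.coe_inj, φE_left_ne_axis, left_ne_axis]

end f

/-- The map `f`, defined on the edge lattice of the disjoint union of `G₊` and `G₋`. -/
noncomputable def fUnion [Fintype E] : (S.PlusEdge ⊕ S.MinusEdge → ℤ) →ₗ[ℤ] (E → ℤ) :=
  S.f ∘ₗ (LinearEquiv.sumArrowLequivProdArrow S.PlusEdge S.MinusEdge ℤ ℤ).toLinearMap

/-- The transpose of `f`. -/
def fTranspose : (E → ℤ) →ₗ[ℤ] (S.PlusEdge ⊕ S.MinusEdge → ℤ) where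
  toFun x := Sum.elim (Sum.elim (fun l => x l + x (S.φE l)) fun p => x p.1)
    fun r => x r - x (S.φE r)
  map_add' x y := by
    ext ((l | p) | r) <;> simp <;> ring
  map_smul' c x := by
    ext ((l | p) | r) <;> simp <;> ring

section fUnion

variable [Fintype E] (y : S.PlusEdge ⊕ S.MinusEdge → ℤ)

theorem fUnion_apply : S.fUnion y = S.f (y ∘ Sum.inl, y ∘ Sum.inr) := rfl

@[simp]
theorem fUnion_left (l : S.LeftEdge) :
    S.fUnion y l = y (.inl (.inl l)) - y (.inr (S.leftEquivRight l)) :=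
  S.f_left _ _ l

@[simp]
theorem fUnion_right (l : S.LeftEdge) :
    S.fUnion y (S.φE l) = y (.inl (.inl l)) + y (.inr (S.leftEquivRight l)) :=
  S.f_right _ _ l

@[simp]
theorem fUnion_axis (a : S.AxisEdge) :
    S.fUnion y a = y (.inl (.inr (a, false))) + y (.inl (.inr (a, true))) :=
  S.f_axis _ _ a

end fUnion

section fTranspose

variable (x : E → ℤ)

@[simp]
theorem fTranspose_left (l : S.LeftEdge) :
    S.fTranspose x (.inl (.inl l)) = x l + x (S.φE l) := rfl

@[simp]
theorem fTranspose_axis (p : S.AxisEdge × Bool) :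
    S.fTranspose x (.inl (.inr p)) = x p.1 := rfl

@[simp]
theorem fTranspose_right (r : S.RightEdge) :
    S.fTranspose x (.inr r) = x r - x (S.φE r) := rfl

end fTranspose

theorem dotProduct_fUnion [Fintype E] (x : E → ℤ) (y : S.PlusEdge ⊕ S.MinusEdge → ℤ) :
    x ⬝ᵥ S.fUnion y = S.fTranspose x ⬝ᵥ y := by
  have h := Equiv.sum_comp S.leftEquivRight fun r => (x r - x (S.φE r)) * y (.inr r)
  simp only [coe_leftEquivRight, φE_φE] at h
  rw [fUnion_apply, dotProduct_f]
  simp only [dotProduct, Fintype.sum_sum_type, fTranspose_left, fTranspose_axis, fTranspose_right,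
    ← h, Function.comp_apply, Fintype.sum_prod_type, Fintype.sum_bool]
  refine congrArg₂ (· + ·) (congrArg₂ (· + ·) ?_ ?_) ?_ <;>
    exact Finset.sum_congr rfl fun _ _ => by ring

theorem fUnion_fTranspose [Fintype E] (x : E → ℤ) : S.fUnion (S.fTranspose x) = (2 : ℤ) • x := by
  ext e
  refine S.edge_cases (P := fun e => S.fUnion (S.fTranspose x) e = ((2 : ℤ) • x) e)
    (fun l => ?_) (fun l => ?_) (fun a => ?_) e
  · simp
    ring
  · simp
    ring
  · simp
    ring

theorem forall_right {P : S.RightEdge → Prop} (h : ∀ l, P (S.leftEquivRight l)) (r) : P r := by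
  have := h (S.leftEquivRight.symm r)
  rwa [Equiv.apply_symm_apply] at this

theorem fTranspose_fUnion_left [Fintype E] (y : S.PlusEdge ⊕ S.MinusEdge → ℤ) (l : S.LeftEdge) :
    S.fTranspose (S.fUnion y) (.inl (.inl l)) = 2 * y (.inl (.inl l)) := by
  simp
  ring

theorem fTranspose_fUnion_axis [Fintype E] (y : S.PlusEdge ⊕ S.MinusEdge → ℤ)
    (p : S.AxisEdge × Bool) : S.fTranspose (S.fUnion y) (.inl (.inr p)) =
      y (.inl (.inr (p.1, false))) + y (.inl (.inr (p.1, true))) := by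
  simp

theorem fTranspose_fUnion_right [Fintype E] (y : S.PlusEdge ⊕ S.MinusEdge → ℤ) (r : S.RightEdge) :
    S.fTranspose (S.fUnion y) (.inr r) = 2 * y (.inr r) := by
  refine S.forall_right (P := fun r => S.fTranspose (S.fUnion y) (.inr r) = 2 * y (.inr r))
    (fun l => ?_) r
  simp
  ring

/-! ### Potentials on G₊ and G₋ as functions on the vertices of G. -/

section vertices

theorem sideV_ne_one_of_left {e : E} (he : S.sideE e = -1 ∨ S.sideE e = 0) {v : V}
    (hv : v ∈ G.ends e) : S.sideV v ≠ 1 := by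
  rcases S.side_of_mem_ends e v hv with h | h <;> rcases he with h' | h' <;> simp [h, h']

theorem φV_eq_of_axis (a : S.AxisEdge) {v : V} (hv : v ∈ G.ends a) : S.φV v = v := by
  rw [← S.sideV_eq_zero_iff]
  rcases S.side_of_mem_ends a v hv with h | h
  · exact h
  · rw [h, a.2]

/-- A pair of functions on the left half, the second of which vanishes on the axis, can be folded
out to a function on all vertices. -/
theorem exists_unfold {R : Type*} [CommRing R] (a b : V → R)
    (hb : ∀ v, S.φV v = v → b v = 0) :
    ∃ w : V → R, ∀ v, S.sideV v ≠ 1 →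
      w v = a v - b (S.φV v) ∧ w (S.φV v) = a v + b (S.φV v) := by
  refine ⟨fun v => if S.sideV v = 1 then a (S.φV v) + b v else a v - b (S.φV v), fun v hv => ?_⟩
  refine ⟨if_neg hv, ?_⟩
  rcases h : S.sideV v with _ | _ | _
  · have h0 := (S.sideV_eq_zero_iff v).mp h
    simp [h0, hv, hb v h0]
  · have : S.sideV (S.φV v) = 1 := by
      rw [S.sideV_φV, h]
      rfl
    simp [this]
  · exact absurd h hv

end vertices

variable {S} {D : OrientedMultigraph V E}

theorem exists_extension {α R : Type*} [Zero R] {p : α → Prop} (w : {a // p a} → R) :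
    ∃ w' : α → R, ∀ a : {a // p a}, w' a = w a :=
  ⟨Function.extend Subtype.val w 0, Subtype.val_injective.extend_apply w 0⟩

theorem mem_bondSpace_plus (h : S.IsInvariantOrientation D) {R : Type*} [CommRing R]
    {x : S.PlusEdge → R} :
    x ∈ (plus h).bondSpace R ↔ ∃ (w : V → R) (m : S.AxisEdge → R),
      (∀ l : S.LeftEdge, w (D.head l) - w (D.tail l) = x (.inl l)) ∧
      ∀ a : S.AxisEdge, m a - w (D.tail a) = x (.inr (a, false)) ∧
        w (D.head a) - m a = x (.inr (a, true)) := by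
  classical
  rw [OrientedMultigraph.mem_bondSpace]
  constructor
  · rintro ⟨w, hw⟩
    obtain ⟨w', hw'⟩ := exists_extension fun v => w (.inl v)
    have key : ∀ v hv, w' v = w (.inl ⟨v, hv⟩) := fun v hv => hw' ⟨v, hv⟩
    refine ⟨w', fun a => w (.inr a), fun l => ?_, fun a => ⟨?_, ?_⟩⟩
    · rw [key _ ⟨l, .inl l.2, h.head_mem l⟩, key _ ⟨l, .inl l.2, h.tail_mem l⟩]
      exact hw (.inl l)
    · rw [key _ ⟨a, .inr a.2, h.tail_mem a⟩]
      exact hw (.inr (a, false))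
    · rw [key _ ⟨a, .inr a.2, h.head_mem a⟩]
      exact hw (.inr (a, true))
  · rintro ⟨w, m, h1, h2⟩
    refine ⟨Sum.elim (fun v => w v) m, ?_⟩
    rintro (l | ⟨a, _ | _⟩)
    · exact h1 l
    · exact (h2 a).1
    · exact (h2 a).2

theorem mem_bondSpace_minus (h : S.IsInvariantOrientation D) {R : Type*} [CommRing R]
    {x : S.MinusEdge → R} :
    x ∈ (minus h).bondSpace R ↔ ∃ w : V → R, (∀ v, S.φV v = v → w v = 0) ∧
      ∀ r : S.RightEdge, w (D.head r) - w (D.tail r) = x r := by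
  classical
  rw [OrientedMultigraph.mem_bondSpace]
  constructor
  · rintro ⟨w, hw⟩
    -- `c` is the value at the merged axis vertex, or 0 if there is none. Subtracting it leaves the
    -- coboundary unchanged and normalizes the potential to vanish on the axis.
    obtain ⟨c, hc⟩ : ∃ c, ∀ a : S.RightEndpoint, S.φV a = a → w (Quot.mk _ a) = c := by
      by_cases hfix : ∃ a : S.RightEndpoint, S.φV a = a
      · obtain ⟨a, ha⟩ := hfix
        exact ⟨w (Quot.mk _ a), fun b hb => congrArg w (Quot.sound ⟨hb, ha⟩)⟩
      · exact ⟨0, fun b hb => absurd ⟨b, hb⟩ hfix⟩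
    let w' : V → R := fun v => if hv : S.φV v ≠ v ∧ ∃ e, S.sideE e = 1 ∧ v ∈ G.ends e then
      w (Quot.mk _ ⟨v, hv.2⟩) - c else 0
    have hw' : ∀ a : S.RightEndpoint, w' a = w (Quot.mk _ a) - c := by
      intro a
      by_cases ha : S.φV a = a
      · rw [hc a ha, sub_self]
        exact dif_neg fun h => h.1 ha
      · exact dif_pos (⟨ha, a.2⟩ : S.φV a ≠ a ∧ ∃ e, S.sideE e = 1 ∧ (a : V) ∈ G.ends e)
    refine ⟨w', fun v hv => dif_neg fun h => h.1 hv, fun r => ?_⟩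
    have h1 := hw' ⟨D.head r, r, r.2, h.head_mem r⟩
    have h2 := hw' ⟨D.tail r, r, r.2, h.tail_mem r⟩
    dsimp only at h1 h2
    rw [h1, h2, sub_sub_sub_cancel_right]
    exact hw r
  · rintro ⟨w, hw0, hw⟩
    refine ⟨Quot.lift (fun v => w v) fun a b hab => ?_, fun r => hw r⟩
    rw [hw0 a hab.1, hw0 b hab.2]

/-- A cycle of `G₊` takes the same value on the two halves of a subdivided edge. -/
theorem eq_of_mem_cycleSpace_plus [Finite V] [Fintype E] (h : S.IsInvariantOrientation D)
    {R : Type*} [CommRing R] {x : S.PlusEdge → R} (hx : x ∈ (plus h).cycleSpace R)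
    (a : S.AxisEdge) : x (.inr (a, false)) = x (.inr (a, true)) := by
  classical
  -- Conservation at the subdividing vertex, which has one edge in and one edge out.
  have := (plus h).mem_cycleSpace_iff'.mp hx (Sum.elim 0 (Pi.single a 1))
  rw [Fintype.sum_sum_type, Fintype.sum_prod_type] at this
  rw [← sub_eq_zero, sub_eq_neg_add]
  simpa [plus, Pi.single_apply, Finset.sum_add_distrib] using this

end ReflectiveSymmetry

/-! ### Invariant orientations, the half-isomorphism, and forests on the axis. -/

namespace ReflectiveSymmetry

variable {V : Type u} {E : Type v} {G : Multigraph V E} (S : ReflectiveSymmetry G)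

/-- Left and axis edges may be oriented arbitrarily, and right edges by reflection. Axis edges cause
no conflict because φ fixes both of their ends. -/
theorem exists_invariantOrientation : ∃ D : OrientedMultigraph V E, S.IsInvariantOrientation D := by
  have hp : ∀ e, ∃ p : V × V, s(p.1, p.2) = G.ends e := fun e =>
    (Sym2.ind (fun a b => ⟨(a, b), rfl⟩) (G.ends e) : ∃ p : V × V, s(p.1, p.2) = G.ends e)
  choose p hp using hp
  let q : E → V × V := fun e =>
    if S.sideE e = 1 then Prod.map S.φV S.φV (p (S.φE e)) else p e
  have hq : ∀ e, s((q e).1, (q e).2) = G.ends e := by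
    intro e
    by_cases he : S.sideE e = 1
    · have := S.ends_φE (S.φE e)
      rw [φE_φE, ← hp (S.φE e)] at this
      simp [q, he, this]
    · simp [q, he, hp]
  have hφ : ∀ e, q (S.φE e) = Prod.map S.φV S.φV (q e) := by
    refine S.edge_cases (fun l => ?_) (fun l => ?_) fun a => ?_
    · have h1 : S.sideE (S.φE l) = 1 := (S.leftEquivRight l).2
      have h2 : S.sideE l ≠ 1 := by
        rw [l.2]
        decide
      simp [q, h1, h2]
    · have h1 : S.sideE (S.φE l) = 1 := (S.leftEquivRight l).2
      have h2 : S.sideE l ≠ 1 := by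
        rw [l.2]
        decide
      simp [q, h1, h2, Prod.map]
    · rw [S.φE_axis a]
      refine Prod.ext ?_ ?_
      · refine (S.φV_eq_of_axis a ?_).symm
        rw [← hq]
        exact Sym2.mem_mk_left _ _
      · refine (S.φV_eq_of_axis a ?_).symm
        rw [← hq]
        exact Sym2.mem_mk_right _ _
  refine ⟨⟨fun e => (q e).1, fun e => (q e).2⟩, ?_, fun e => ?_, fun e => ?_⟩
  · simp only [OrientedMultigraph.toMultigraph, hq]
  · exact congrArg Prod.fst (hφ e)
  · exact congrArg Prod.snd (hφ e)

/-- The vectors that vanish on the edges of the axis. -/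
def axisFreeVectors : Submodule (ZMod 2) (E → ZMod 2) where
  carrier := {x | ∀ e, S.φE e = e → x e = 0}
  add_mem' := fun hx hy e he => by simp only [Pi.add_apply, hx e he, hy e he, add_zero]
  zero_mem' := fun _ _ => rfl
  smul_mem' := fun c x hx e he => by simp only [Pi.smul_apply, hx e he, smul_zero]

theorem freeFixedBicycles_eq [Fintype E] (D : OrientedMultigraph V E) :
    S.freeFixedBicycles D = D.bicycleSpace ⊓ (invariantVectors S.φE ⊓ S.axisFreeVectors) :=
  inf_assoc _ _ _

theorem reduceModTwo_mem_axisFree_iff (x : E → ℤ) :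
    reduceModTwo E x ∈ invariantVectors S.φE ⊓ S.axisFreeVectors ↔
      reduceModTwo _ (S.fTranspose x) = 0 := by
  constructor
  · rintro ⟨h1, h2⟩
    ext ((l | p) | r)
    · have := h1 l
      simp only [reduceModTwo_apply] at this
      simp only [reduceModTwo_apply, fTranspose_left, Int.cast_add, this, CharTwo.add_self_eq_zero]
      rfl
    · exact h2 _ (S.φE_axis p.1)
    · have := h1 r
      simp only [reduceModTwo_apply] at this
      simp [this]
  · intro h
    have hl : ∀ l : S.LeftEdge, (x l : ZMod 2) = x (S.φE l) := fun l => by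
      have := congrFun h (.inl (.inl l))
      simp only [reduceModTwo_apply, fTranspose_left, Int.cast_add] at this
      rwa [← CharTwo.sub_eq_add, Pi.zero_apply, sub_eq_zero] at this
    refine ⟨?_, fun e he => ?_⟩
    · refine S.edge_cases (fun l => ?_) (fun l => ?_) fun a => ?_
      · exact (hl l).symm
      · rw [φE_φE]
        exact hl l
      · rw [S.φE_axis a]
    · exact congrFun h (.inl (.inr (⟨e, (S.sideE_eq_zero_iff e).mpr he⟩, false)))

theorem reduceModTwo_mem_invariant_iff [Fintype E] (y : S.PlusEdge ⊕ S.MinusEdge → ℤ) :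
    reduceModTwo _ y ∈ invariantVectors S.ψ ↔ reduceModTwo E (S.fUnion y) = 0 := by
  constructor
  · intro h
    funext e
    refine S.edge_cases (P := fun e => reduceModTwo E (S.fUnion y) e = 0)
      (fun l => ?_) (fun l => ?_) (fun a => ?_) e
    · have : (y (.inr (S.leftEquivRight l)) : ZMod 2) = y (.inl (.inl l)) := h (.inl (.inl l))
      simp [this]
    · have : (y (.inr (S.leftEquivRight l)) : ZMod 2) = y (.inl (.inl l)) := h (.inl (.inl l))
      simp [this, CharTwo.add_self_eq_zero]
    · have : (y (.inl (.inr (a, true))) : ZMod 2) = y (.inl (.inr (a, false))) :=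
        h (.inl (.inr (a, false)))
      simp [this, CharTwo.add_self_eq_zero]
  · intro h
    have hl : ∀ l : S.LeftEdge,
        (y (.inr (S.leftEquivRight l)) : ZMod 2) = y (.inl (.inl l)) := fun l => by
      have := congrFun h (l : E)
      simp only [reduceModTwo_apply, fUnion_left, Int.cast_sub] at this
      exact (sub_eq_zero.mp this).symm
    have ha : ∀ a : S.AxisEdge,
        (y (.inl (.inr (a, true))) : ZMod 2) = y (.inl (.inr (a, false))) := fun a => by
      have := congrFun h (a : E)
      simp only [reduceModTwo_apply, fUnion_axis, Int.cast_add, ← CharTwo.sub_eq_add] at this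
      exact (sub_eq_zero.mp this).symm
    rintro ((l | ⟨a, _ | _⟩) | r)
    · exact hl l
    · exact ha a
    · exact (ha a).symm
    · have := hl (S.leftEquivRight.symm r)
      rw [Equiv.apply_symm_apply] at this
      exact this.symm

variable {S} {D : OrientedMultigraph V E} (h : S.IsInvariantOrientation D)
include h

theorem IsInvariantOrientation.sideV_tail_ne_one {e : E} (he : S.sideE e = -1 ∨ S.sideE e = 0) :
    S.sideV (D.tail e) ≠ 1 := S.sideV_ne_one_of_left he (h.tail_mem e)

theorem IsInvariantOrientation.sideV_head_ne_one {e : E} (he : S.sideE e = -1 ∨ S.sideE e = 0) :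
    S.sideV (D.head e) ≠ 1 := S.sideV_ne_one_of_left he (h.head_mem e)

theorem IsInvariantOrientation.φV_tail (a : S.AxisEdge) : S.φV (D.tail a) = D.tail a :=
  S.φV_eq_of_axis a (h.tail_mem a)

theorem IsInvariantOrientation.φV_head (a : S.AxisEdge) : S.φV (D.head a) = D.head a :=
  S.φV_eq_of_axis a (h.head_mem a)

/-- Potentials w on G₊ and w' on G₋, the latter zero on the axis, unfold to w - w'∘φ on the left and
its mirror counterpart with a plus sign on the right. On an axis edge the value at the subdividing
vertex cancels in the sum of the two halves. -/
theorem fUnion_mem_bondSpace [Fintype E] {y : S.PlusEdge ⊕ S.MinusEdge → ℤ}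
    (hy : y ∈ ((plus h).disjointUnion (minus h)).bondSpace ℤ) : S.fUnion y ∈ D.bondSpace ℤ := by
  rw [OrientedMultigraph.mem_bondSpace_disjointUnion, mem_bondSpace_plus, mem_bondSpace_minus] at hy
  obtain ⟨⟨w, m, h1, h2⟩, w', h0, h3⟩ := hy
  obtain ⟨W, hW⟩ := S.exists_unfold w w' h0
  refine D.mem_bondSpace.mpr ⟨W, ?_⟩
  have h3' : ∀ l : S.LeftEdge, w' (S.φV (D.head l)) - w' (S.φV (D.tail l)) =
      y (.inr (S.leftEquivRight l)) := fun l => by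
    have := h3 (S.leftEquivRight l)
    rwa [coe_leftEquivRight, h.head_φE, h.tail_φE] at this
  refine S.edge_cases (fun l => ?_) (fun l => ?_) fun a => ?_
  · rw [(hW _ (h.sideV_head_ne_one (.inl l.2))).1, (hW _ (h.sideV_tail_ne_one (.inl l.2))).1,
      fUnion_left, ← h3', sub_sub_sub_comm, h1]
    rfl
  · rw [h.head_φE, h.tail_φE, (hW _ (h.sideV_head_ne_one (.inl l.2))).2,
      (hW _ (h.sideV_tail_ne_one (.inl l.2))).2, fUnion_right, ← h3', add_sub_add_comm, h1]
    rfl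
  · rw [(hW _ (h.sideV_head_ne_one (.inr a.2))).1, (hW _ (h.sideV_tail_ne_one (.inr a.2))).1,
      h.φV_head, h.φV_tail, h0 _ (h.φV_head a), h0 _ (h.φV_tail a), fUnion_axis]
    have := congrArg₂ (· + ·) (h2 a).1 (h2 a).2
    simp only [Function.comp_apply] at this
    rw [← this]
    ring

theorem fTranspose_mem_bondSpace {x : E → ℤ} (hx : x ∈ D.bondSpace ℤ) :
    S.fTranspose x ∈ ((plus h).disjointUnion (minus h)).bondSpace ℤ := by
  obtain ⟨w, hw⟩ := D.mem_bondSpace.mp hx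
  rw [OrientedMultigraph.mem_bondSpace_disjointUnion, mem_bondSpace_plus, mem_bondSpace_minus]
  -- The folded potential is `2 * w` on the axis; the subdividing vertex takes the midpoint value,
  -- so that each half carries the full difference `x a`.
  refine ⟨⟨fun v => w v + w (S.φV v), fun a => w (D.tail a) + w (D.head a), fun l => ?_,
    fun a => ⟨?_, ?_⟩⟩, fun v => w v - w (S.φV v), fun v hv => by simp [hv], fun r => ?_⟩
  · simp only [Function.comp_apply, fTranspose_left, ← hw, h.head_φE, h.tail_φE]
    ring
  · simp only [Function.comp_apply, fTranspose_axis, ← hw, h.φV_tail]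
    ring
  · simp only [Function.comp_apply, fTranspose_axis, ← hw, h.φV_head]
    ring
  · simp only [Function.comp_apply, fTranspose_right, ← hw, h.head_φE, h.tail_φE]
    ring

theorem halfIsomorphism [Finite V] [Fintype E] :
    HalfIsomorphism ((plus h).disjointUnion (minus h)) D S.fUnion S.fTranspose where
  adjoint := S.dotProduct_fUnion
  map_bond _ := fUnion_mem_bondSpace h
  adjoint_map_bond _ := fTranspose_mem_bondSpace h
  comp_adjoint := S.fUnion_fTranspose
  adjoint_comp_sub_mem y := by
    rw [OrientedMultigraph.mem_bondSpace_disjointUnion, mem_bondSpace_plus, mem_bondSpace_minus]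
    -- The error of g∘f against 2 lives on the subdivided edges, with opposite values on the two
    -- halves; it is the bond of a potential supported on the subdividing vertices.
    refine ⟨⟨0, fun a => y (.inl (.inr (a, true))) - y (.inl (.inr (a, false))), fun l => ?_,
      fun a => ⟨?_, ?_⟩⟩, 0, fun v hv => rfl, fun r => ?_⟩
    · simp only [Function.comp_apply, Pi.sub_apply, Pi.smul_apply, fTranspose_fUnion_left]
      simp
    · simp only [Function.comp_apply, Pi.sub_apply, Pi.smul_apply, fTranspose_fUnion_axis]
      simp
      ring
    · simp only [Function.comp_apply, Pi.sub_apply, Pi.smul_apply, fTranspose_fUnion_axis]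
      simp
      ring
    · simp only [Function.comp_apply, Pi.sub_apply, Pi.smul_apply, fTranspose_fUnion_right]
      simp
  adjoint_comp_of_mem_cycleSpace y hy := by
    have hy' := eq_of_mem_cycleSpace_plus h (OrientedMultigraph.mem_cycleSpace_disjointUnion.mp hy).1
    ext ((l | ⟨a, b⟩) | r)
    · exact S.fTranspose_fUnion_left y l
    · have := hy' a
      simp only [Function.comp_apply] at this
      rw [S.fTranspose_fUnion_axis]
      cases b <;> simp [this, two_mul]
    · exact S.fTranspose_fUnion_right y r

/-- If the edges of the axis form a forest, then invariant cycles do not meet the axis. -/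
theorem axisFree_of_forest [Fintype V] [Fintype E] (hS : S.FixedEdgesFormForest) {x : E → ZMod 2}
    (hx : x ∈ D.cycleSpace (ZMod 2)) (hφ : x ∈ invariantVectors S.φE) : x ∈ S.axisFreeVectors := by
  classical
  obtain ⟨hloop, hpar, hacyc⟩ := hS
  intro e he
  set F := SimpleGraph.fromEdgeSet {p | ∃ e, S.φE e = e ∧ G.ends e = p}
  have hends : ∀ e, G.ends e = s(D.tail e, D.head e) := fun e => by
    rw [← h.toMultigraph_eq]
    rfl
  have hadj : ∀ e', S.φE e' = e' → F.Adj (D.tail e') (D.head e') := fun e' he' => by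
    rw [SimpleGraph.fromEdgeSet_adj]
    refine ⟨⟨e', he', hends e'⟩, fun heq => hloop e' he' ?_⟩
    rw [hends, heq]
    exact Sym2.mk_isDiag_iff.mpr rfl
  have hbridge := SimpleGraph.isAcyclic_iff_forall_isBridge.mp hacyc
    (F.mem_edgeSet.mpr (hadj e he))
  rw [SimpleGraph.isBridge_iff] at hbridge
  set F' := F.deleteEdges {s(D.tail e, D.head e)}
  -- The cut on the axis vertices given by one side of the bridge `e`. Since `w` and `x` are
  -- invariant, off-axis edges cancel in pairs mod 2, and `e` is the only axis edge in the cut;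
  -- orthogonality to `x` then reads `x e = 0`.
  let w : V → ZMod 2 := fun v => if S.φV v = v ∧ F'.Reachable (D.tail e) v then 1 else 0
  have hsum := D.mem_cycleSpace_iff'.mp hx w
  have hw : ∀ v, w (S.φV v) = w v := fun v => by
    by_cases hv : S.φV v = v
    · rw [hv]
    · have : S.φV (S.φV v) ≠ S.φV v := fun h' => hv (S.φV_involutive.injective h')
      simp only [w, hv, this, false_and, if_false]
  rw [S.sum_edges] at hsum
  have hcancel : ∑ l : S.LeftEdge, x (S.φE l) * (w (D.head (S.φE l)) - w (D.tail (S.φE l))) =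
      ∑ l : S.LeftEdge, x l * (w (D.head l) - w (D.tail l)) :=
    Finset.sum_congr rfl fun l _ => by rw [h.head_φE, h.tail_φE, hw, hw, hφ l]
  rw [hcancel, CharTwo.add_self_eq_zero, zero_add,
    Finset.sum_eq_single ⟨e, (S.sideE_eq_zero_iff e).mpr he⟩ ?_ (by simp)] at hsum
  · have h1 : w (D.head e) = 0 := if_neg fun h' => hbridge h'.2
    have h2 : w (D.tail e) = 1 :=
      if_pos ⟨h.φV_tail ⟨e, (S.sideE_eq_zero_iff e).mpr he⟩, .refl _⟩
    simpa [h1, h2] using hsum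
  · rintro a - ha
    have hfix := S.φE_axis a
    have hadj' : F'.Adj (D.tail a) (D.head a) := by
      rw [SimpleGraph.deleteEdges_adj]
      refine ⟨hadj a hfix, fun heq => ha (Subtype.ext (hpar _ _ hfix he ?_))⟩
      rw [hends, hends]
      exact heq
    have : w (D.head a) = w (D.tail a) := by
      simp only [w, h.φV_head, h.φV_tail, true_and]
      congr 1
      exact propext ⟨fun h' => h'.trans hadj'.symm.reachable, fun h' => h'.trans hadj'.reachable⟩
    rw [this, sub_self, mul_zero]

theorem freeFixedBicycles_eq_of_forest [Fintype V] [Fintype E] (hS : S.FixedEdgesFormForest) :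
    S.freeFixedBicycles D = S.fixedBicycles D :=
  inf_eq_left.mpr fun _ hx => axisFree_of_forest h hS hx.1.1 hx.2

end ReflectiveSymmetry

/-! ### The dimension count by the Laplace form of G₊ mod 2. -/

theorem OrientedMultigraph.eq_of_connected {V : Type u} {E : Type v} {D : OrientedMultigraph V E}
    (hD : D.toMultigraph.Connected) {R : Type*} {w : V → R}
    (hw : ∀ e, w (D.head e) = w (D.tail e)) (a b : V) : w a = w b := by
  obtain ⟨p⟩ := hD.preconnected a b
  induction p with
  | nil => rfl
  | cons hadj _ ih =>
    refine Eq.trans ?_ ih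
    obtain ⟨⟨e, he⟩, -⟩ := (SimpleGraph.fromEdgeSet_adj _).mp hadj
    rcases Sym2.eq_iff.mp he with ⟨rfl, rfl⟩ | ⟨rfl, rfl⟩
    · exact (hw e).symm
    · exact hw e

namespace ReflectiveSymmetry

variable {V : Type u} {E : Type v} {G : Multigraph V E} {S : ReflectiveSymmetry G}
  {D : OrientedMultigraph V E}

section potentials

variable (S) in
/-- The function on the vertices of `G₊` with prescribed values on the vertices of `G` and on the
subdividing vertices. -/
def plusPotential {R : Type*} (a : V → R) (m : S.AxisEdge → R) : S.PlusVertex → R :=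
  Sum.elim (fun v => a v) m

theorem exists_eq_plusPotential {R : Type*} [Zero R] (u : S.PlusVertex → R) :
    ∃ a m, u = S.plusPotential a m := by
  obtain ⟨a, ha⟩ := exists_extension fun v => u (.inl v)
  exact ⟨a, fun e => u (.inr e), funext (Sum.rec (fun v => (ha v).symm) fun _ => rfl)⟩

variable {R : Type*} [CommRing R] (h : S.IsInvariantOrientation D) (a : V → R)
  (m : S.AxisEdge → R)

@[simp]
theorem coboundary_plusPotential_left (l : S.LeftEdge) :
    (plus h).coboundary R (S.plusPotential a m) (.inl l) = a (D.head l) - a (D.tail l) := rfl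

@[simp]
theorem coboundary_plusPotential_false (e : S.AxisEdge) :
    (plus h).coboundary R (S.plusPotential a m) (.inr (e, false)) = m e - a (D.tail e) := rfl

@[simp]
theorem coboundary_plusPotential_true (e : S.AxisEdge) :
    (plus h).coboundary R (S.plusPotential a m) (.inr (e, true)) = a (D.head e) - m e := rfl

theorem coboundary_dotProduct_coboundary [Fintype E] (ha : ∀ v, S.φV v = v → a v = 0)
    (b : V → R) (n : S.AxisEdge → R) :
    (plus h).coboundary R (S.plusPotential a m) ⬝ᵥ (plus h).coboundary R (S.plusPotential b n) =
      ∑ l : S.LeftEdge, (a (D.head l) - a (D.tail l)) * (b (D.head l) - b (D.tail l)) +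
        ∑ e : S.AxisEdge, m e * (2 * n e - b (D.head e) - b (D.tail e)) := by
  simp only [dotProduct, Fintype.sum_sum_type, Fintype.sum_prod_type, Fintype.sum_bool,
    coboundary_plusPotential_left, coboundary_plusPotential_false, coboundary_plusPotential_true,
    ha _ (h.φV_head _), ha _ (h.φV_tail _)]
  congr 1
  exact Finset.sum_congr rfl fun e _ => by ring

end potentials

section dimensions

variable (h : S.IsInvariantOrientation D)
  (hV : ∀ v, S.φV v = v → ∃ e, (S.sideE e = -1 ∨ S.sideE e = 0) ∧ v ∈ G.ends e)

/-- The inclusion of the vertices of the axis into the vertices of `G₊`. -/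
def axisVertex (v : {v : V // S.φV v = v}) : S.PlusVertex := .inl ⟨v, hV v v.2⟩

/-- The functions on the vertices of `G₊` that vanish on the axis. -/
def vanishingPotentials : Submodule (ZMod 2) (S.PlusVertex → ZMod 2) :=
  LinearMap.ker (LinearMap.funLeft (ZMod 2) (ZMod 2) (axisVertex hV))

theorem plusPotential_mem_vanishing {a : V → ZMod 2} {m : S.AxisEdge → ZMod 2} :
    S.plusPotential a m ∈ vanishingPotentials hV ↔ ∀ v, S.φV v = v → a v = 0 := by
  rw [vanishingPotentials, LinearMap.mem_ker, funext_iff, Subtype.forall]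
  rfl

theorem finrank_vanishingPotentials [Finite V] [Fintype E] :
    Nat.card {v : V // S.φV v = v} + Module.finrank (ZMod 2) (vanishingPotentials hV) =
      Module.finrank (ZMod 2) (S.PlusVertex → ZMod 2) := by
  classical
  have := Fintype.ofFinite V
  rw [← LinearMap.finrank_range_add_finrank_ker
    (LinearMap.funLeft (ZMod 2) (ZMod 2) (axisVertex hV)),
    LinearMap.range_eq_top.mpr (LinearMap.funLeft_surjective_of_injective _ _ _ ?_), finrank_top,
    Module.finrank_fintype_fun_eq_card, Nat.card_eq_fintype_card]
  · rfl
  · intro v w hvw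
    exact Subtype.ext (Subtype.mk.inj (Sum.inl.inj hvw))

/-- The extension of a vector on the edges of `G₊` to a symmetric vector on the edges of `G₊` and
`G₋`. -/
def extendToMinus : (S.PlusEdge → ZMod 2) →ₗ[ZMod 2] (S.PlusEdge ⊕ S.MinusEdge → ZMod 2) :=
  LinearMap.funLeft _ _ (Sum.elim id fun r => .inl (S.leftEquivRight.symm r))

/-- The extension of a vector on the left edges to a symmetric vector that vanishes on the axis. -/
def extendByReflection : (S.PlusEdge → ZMod 2) →ₗ[ZMod 2] (E → ZMod 2) where
  toFun x e := if he : S.sideE e = -1 then x (.inl ⟨e, he⟩) else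
    if he : S.sideE e = 1 then x (.inl (S.leftEquivRight.symm ⟨e, he⟩)) else 0
  map_add' x y := by
    ext e
    dsimp only [Pi.add_apply]
    split_ifs <;> simp
  map_smul' c x := by
    ext e
    dsimp only [Pi.smul_apply]
    split_ifs <;> simp

@[simp]
theorem extendByReflection_left (x : S.PlusEdge → ZMod 2) (l : S.LeftEdge) :
    extendByReflection x l = x (.inl l) := dif_pos l.2

@[simp]
theorem extendByReflection_right (x : S.PlusEdge → ZMod 2) (l : S.LeftEdge) :
    extendByReflection x (S.φE l) = x (.inl l) := by
  have h1 : S.sideE (S.φE l) = 1 := (S.leftEquivRight l).2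
  have h2 : S.sideE (S.φE l) ≠ -1 := by
    rw [h1]
    decide
  refine (dif_neg h2).trans ((dif_pos h1).trans ?_)
  exact congrArg (fun l => x (.inl l)) (S.leftEquivRight.symm_apply_apply l)

@[simp]
theorem extendByReflection_axis (x : S.PlusEdge → ZMod 2) (a : S.AxisEdge) :
    extendByReflection x a = 0 := by
  have h1 : S.sideE a ≠ 1 := by
    rw [a.2]
    decide
  have h2 : S.sideE a ≠ -1 := by
    rw [a.2]
    decide
  exact (dif_neg h2).trans (dif_neg h1)

variable [Fintype E]

/-- The bilinear form on potentials that is given by the Laplace matrix of `G₊`. -/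
noncomputable def plusLaplaceForm : LinearMap.BilinForm (ZMod 2) (S.PlusVertex → ZMod 2) :=
  (dotProductBilin (ZMod 2) (ZMod 2)).compl₁₂ ((plus h).coboundary (ZMod 2))
    ((plus h).coboundary (ZMod 2))

theorem plusLaplaceForm_apply (u w : S.PlusVertex → ZMod 2) :
    plusLaplaceForm h u w =
      (plus h).coboundary (ZMod 2) u ⬝ᵥ (plus h).coboundary (ZMod 2) w := rfl

theorem isRefl_plusLaplaceForm : (plusLaplaceForm h).IsRefl := fun u w huw => by
  rw [plusLaplaceForm_apply, dotProduct_comm]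
  exact huw

/-- The test values on the subdividing vertices and those off the axis vary independently. At a
subdividing vertex the term `2 * n e` vanishes mod 2, so `n` is unconstrained and only `b (D.head e)
= b (D.tail e)` remains. -/
theorem plusPotential_mem_orthogonal_iff {b : V → ZMod 2} {n : S.AxisEdge → ZMod 2} :
    S.plusPotential b n ∈ (plusLaplaceForm h).orthogonal (vanishingPotentials hV) ↔
      (∀ e : S.AxisEdge, b (D.head e) = b (D.tail e)) ∧
      ∀ a : V → ZMod 2, (∀ v, S.φV v = v → a v = 0) →
        ∑ l : S.LeftEdge, (a (D.head l) - a (D.tail l)) * (b (D.head l) - b (D.tail l)) = 0 := by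
  classical
  have h2 : (2 : ZMod 2) = 0 := rfl
  rw [LinearMap.BilinForm.mem_orthogonal_iff]
  constructor
  · intro H
    have key : ∀ (a : V → ZMod 2) (m : S.AxisEdge → ZMod 2), (∀ v, S.φV v = v → a v = 0) →
        _ = (0 : ZMod 2) := fun a m ha =>
      (coboundary_dotProduct_coboundary h a m ha b n).symm.trans
        (H _ ((plusPotential_mem_vanishing hV).mpr ha))
    refine ⟨fun e => ?_, fun a ha => ?_⟩
    · have := key 0 (Pi.single e 1) fun _ _ => rfl
      simp only [Pi.zero_apply, sub_self, zero_mul, Finset.sum_const_zero, zero_add,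
        Pi.single_apply, ite_mul, one_mul, Finset.sum_ite_eq', Finset.mem_univ, if_true, h2,
        zero_sub] at this
      rw [CharTwo.neg_eq] at this
      exact sub_eq_zero.mp this
    · simpa using key a 0 ha
  · rintro ⟨H1, H2⟩ u hu
    obtain ⟨a, m, rfl⟩ := exists_eq_plusPotential u
    rw [plusPotential_mem_vanishing] at hu
    refine (coboundary_dotProduct_coboundary h a m hu b n).trans ?_
    rw [H2 a hu, zero_add]
    refine Finset.sum_eq_zero fun e _ => ?_
    rw [H1, h2, zero_mul, zero_sub, CharTwo.neg_eq, sub_self, mul_zero]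

/-- Reflecting b gives a symmetric bond, zero on the axis edges as b agrees at their ends. By
symmetry, pairing it with ∂ᵗw over G equals pairing with ∂ᵗ(w + w∘φ) over the left edges, and w +
w∘φ vanishes on the axis mod 2; so the orthogonality condition says that the bond is a cycle. -/
theorem map_orthogonal_eq_freeFixedBicycles [Finite V] :
    ((plusLaplaceForm h).orthogonal (vanishingPotentials hV)).map
      (extendByReflection ∘ₗ (plus h).coboundary (ZMod 2)) = S.freeFixedBicycles D := by
  classical
  rw [freeFixedBicycles_eq]
  apply le_antisymm
  · rintro _ ⟨u, hu, rfl⟩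
    obtain ⟨b, n, rfl⟩ := exists_eq_plusPotential u
    obtain ⟨H1, H2⟩ := (plusPotential_mem_orthogonal_iff h hV).mp hu
    refine ⟨⟨?_, ?_⟩, ?_, ?_⟩
    · refine D.mem_cycleSpace_iff'.mpr fun w => ?_
      rw [S.sum_edges]
      have := H2 (fun v => w v + w (S.φV v)) fun v hv => by
        rw [hv, CharTwo.add_self_eq_zero]
      simp only [LinearMap.comp_apply, extendByReflection_left, extendByReflection_right,
        extendByReflection_axis, coboundary_plusPotential_left, zero_mul, Finset.sum_const_zero,
        add_zero, h.head_φE, h.tail_φE]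
      rw [← Finset.sum_add_distrib, ← this]
      exact Finset.sum_congr rfl fun l _ => by ring
    · obtain ⟨W, hW⟩ := S.exists_unfold b 0 fun _ _ => rfl
      refine D.mem_bondSpace.mpr ⟨W, S.edge_cases (fun l => ?_) (fun l => ?_) fun a => ?_⟩
      · rw [(hW _ (h.sideV_head_ne_one (.inl l.2))).1, (hW _ (h.sideV_tail_ne_one (.inl l.2))).1]
        simp
      · rw [h.head_φE, h.tail_φE, (hW _ (h.sideV_head_ne_one (.inl l.2))).2,
          (hW _ (h.sideV_tail_ne_one (.inl l.2))).2]
        simp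
      · rw [(hW _ (h.sideV_head_ne_one (.inr a.2))).1, (hW _ (h.sideV_tail_ne_one (.inr a.2))).1]
        simp [H1]
    · exact S.edge_cases (fun l => by simp) (fun l => by simp) fun a => by rw [S.φE_axis a]
    · intro e he
      exact extendByReflection_axis _ ⟨e, (S.sideE_eq_zero_iff e).mpr he⟩
  · rintro x ⟨⟨hZ, hB⟩, hφ, hx⟩
    obtain ⟨W, hW⟩ := D.mem_bondSpace.mp hB
    refine ⟨S.plusPotential W 0, (plusPotential_mem_orthogonal_iff h hV).mpr ⟨fun e => ?_,
      fun a ha => ?_⟩, ?_⟩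
    · rw [← sub_eq_zero, hW]
      exact hx e (S.φE_axis e)
    · have hsum := D.mem_cycleSpace_iff'.mp hZ fun v => if S.sideV v = 1 then 0 else a v
      have hright : ∀ v, S.sideV v ≠ 1 →
          (if S.sideV (S.φV v) = 1 then 0 else a (S.φV v)) = 0 := by
        intro v hv
        rw [S.sideV_φV]
        rcases hs : S.sideV v with _ | _ | _
        · have hv' := (S.sideV_eq_zero_iff v).mp hs
          rw [hv', ha v hv', ite_self]
        · rfl
        · exact absurd hs hv
      rw [S.sum_edges] at hsum
      have hr : ∀ l : S.LeftEdge, x (S.φE l) *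
          ((if S.sideV (D.head (S.φE l)) = 1 then 0 else a (D.head (S.φE l))) -
            (if S.sideV (D.tail (S.φE l)) = 1 then 0 else a (D.tail (S.φE l)))) = 0 := fun l => by
        rw [h.head_φE, h.tail_φE, hright _ (h.sideV_head_ne_one (.inl l.2)),
          hright _ (h.sideV_tail_ne_one (.inl l.2)), sub_self, mul_zero]
      have ha' : ∀ e : S.AxisEdge, x e = 0 := fun e => hx e (S.φE_axis e)
      simp only [hr, ha', zero_mul, Finset.sum_const_zero, add_zero] at hsum
      rw [← hsum]
      refine Finset.sum_congr rfl fun l _ => ?_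
      rw [hW, if_neg (h.sideV_head_ne_one (.inl l.2)), if_neg (h.sideV_tail_ne_one (.inl l.2)),
        mul_comm]
    · funext e
      refine S.edge_cases (P := fun e => _ = x e) (fun l => ?_) (fun l => ?_) (fun a => ?_) e
      · simpa using hW l
      · simpa [hφ (l : E)] using hW l
      · simp [hx a (S.φE_axis a)]

/-- A potential that vanishes on the axis reflects to one on G₋, where the axis is a single vertex.
Lying in the radical makes its coboundary a cycle of G₊, and testing only against potentials zero on
the axis makes the reflection a cycle of G₋. -/
theorem map_radical_eq_plusMinusFixedBicycles [Finite V] :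
    (vanishingPotentials hV ⊓ (plusLaplaceForm h).orthogonal ⊤).map
      (extendToMinus ∘ₗ (plus h).coboundary (ZMod 2)) = plusMinusFixedBicycles h := by
  apply le_antisymm
  · rintro _ ⟨u, ⟨hu, hu'⟩, rfl⟩
    obtain ⟨a, m, rfl⟩ := exists_eq_plusPotential u
    rw [SetLike.mem_coe, plusPotential_mem_vanishing] at hu
    refine ⟨⟨OrientedMultigraph.mem_cycleSpace_disjointUnion.mpr ⟨?_, ?_⟩,
      OrientedMultigraph.mem_bondSpace_disjointUnion.mpr ⟨⟨_, rfl⟩, ?_⟩⟩, ?_⟩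
    · refine (plus h).mem_cycleSpace_iff.mpr ?_
      rintro _ ⟨w, rfl⟩
      rw [dotProduct_comm]
      exact LinearMap.BilinForm.mem_orthogonal_iff.mp hu' w trivial
    · refine (minus h).mem_cycleSpace_iff.mpr fun b hb => ?_
      obtain ⟨w, hw0, hw⟩ := (mem_bondSpace_minus h).mp hb
      have := LinearMap.BilinForm.mem_orthogonal_iff.mp hu'
        (S.plusPotential (fun v => w (S.φV v)) 0) trivial
      have := (coboundary_dotProduct_coboundary h (fun v => w (S.φV v)) 0
        (fun v hv => by rw [hv, hw0 v hv]) a m).symm.trans this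
      rw [dotProduct, ← Equiv.sum_comp S.leftEquivRight, ← this]
      simp only [Pi.zero_apply, zero_mul, Finset.sum_const_zero, add_zero]
      refine Finset.sum_congr rfl fun l _ => ?_
      rw [← hw, coe_leftEquivRight, h.head_φE, h.tail_φE, mul_comm]
      simp [extendToMinus, LinearMap.funLeft_apply]
    · refine (mem_bondSpace_minus h).mpr ⟨fun v => a (S.φV v), fun v hv => ?_,
        S.forall_right fun l => ?_⟩
      · simp only [hv, hu v hv]
      · simp [extendToMinus, LinearMap.funLeft_apply, h.head_φE, h.tail_φE]
    · rintro ((l | ⟨e, _ | _⟩) | r)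
      · exact congrArg (fun l => a (D.head l.1) - a (D.tail l.1))
          (S.leftEquivRight.symm_apply_apply l)
      · change a (D.head e) - m e = m e - a (D.tail e)
        rw [hu _ (h.φV_head e), hu _ (h.φV_tail e), sub_zero, zero_sub, CharTwo.neg_eq]
      · change m e - a (D.tail e) = a (D.head e) - m e
        rw [hu _ (h.φV_head e), hu _ (h.φV_tail e), sub_zero, zero_sub, CharTwo.neg_eq]
      · rfl
  · rintro x ⟨⟨hZ, hB⟩, hψ⟩
    -- The potential is taken from G₋, where it can be normalized to vanish on the axis, and
    -- reflected to the left by ψ-invariance. The value at a subdividing vertex is forced, because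
    -- both neighbours carry 0.
    obtain ⟨w, hw0, hw⟩ :=
      (mem_bondSpace_minus h).mp (OrientedMultigraph.mem_bondSpace_disjointUnion.mp hB).2
    have hw' : ∀ l : S.LeftEdge, w (S.φV (D.head l)) - w (S.φV (D.tail l)) = x (.inl (.inl l)) := by
      intro l
      rw [← h.head_φE, ← h.tail_φE, ← coe_leftEquivRight, hw]
      exact hψ (.inl (.inl l))
    have hu0 : ∀ v, S.φV v = v → w (S.φV v) = 0 := fun v hv => by rw [hv, hw0 v hv]
    have hcob : (plus h).coboundary (ZMod 2) (S.plusPotential (fun v => w (S.φV v))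
        fun e => x (.inl (.inr (e, false)))) = x ∘ Sum.inl := by
      ext (l | ⟨e, _ | _⟩)
      · exact hw' l
      · rw [coboundary_plusPotential_false, hu0 _ (h.φV_tail e), sub_zero]
        rfl
      · rw [coboundary_plusPotential_true, hu0 _ (h.φV_head e), zero_sub, CharTwo.neg_eq]
        exact hψ (.inl (.inr (e, true)))
    refine ⟨S.plusPotential (fun v => w (S.φV v)) fun e => x (.inl (.inr (e, false))),
      ⟨(plusPotential_mem_vanishing hV).mpr hu0, ?_⟩, ?_⟩
    · refine LinearMap.BilinForm.mem_orthogonal_iff.mpr fun u _ => ?_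
      rw [plusLaplaceForm_apply, hcob, dotProduct_comm]
      exact (plus h).mem_cycleSpace_iff.mp
        (OrientedMultigraph.mem_cycleSpace_disjointUnion.mp hZ).1 _ ⟨u, rfl⟩
    · rw [LinearMap.comp_apply, hcob]
      ext (e | r)
      · rfl
      · exact hψ (.inr r)


theorem finrank_plusMinusFixedBicycles [Finite V]
    (hconn : (plus h).toMultigraph.Connected) (hne : ∃ v, S.φV v = v) :
    Module.finrank (ZMod 2) (plusMinusFixedBicycles h) = Module.finrank (ZMod 2)
      (vanishingPotentials hV ⊓ (plusLaplaceForm h).orthogonal ⊤ : Submodule _ _) := by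
  rw [← map_radical_eq_plusMinusFixedBicycles h hV]
  set U := vanishingPotentials hV ⊓ (plusLaplaceForm h).orthogonal ⊤
  set T := extendToMinus ∘ₗ (plus h).coboundary (ZMod 2)
  have hinj : Function.Injective (T.domRestrict U) := by
    rw [injective_iff_map_eq_zero]
    rintro ⟨u, hu⟩ hTu
    refine Subtype.ext (funext fun i => ?_)
    obtain ⟨v, hv⟩ := hne
    have h1 : u (axisVertex hV ⟨v, hv⟩) = 0 := congrFun hu.1 ⟨v, hv⟩
    exact (OrientedMultigraph.eq_of_connected hconn
      (fun e => sub_eq_zero.mp (congrFun hTu (.inl e))) i (axisVertex hV ⟨v, hv⟩)).trans h1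
  rw [← LinearMap.range_domRestrict, LinearMap.finrank_range_of_inj hinj]

theorem finrank_freeFixedBicycles [Finite V]
    (hconn : (plus h).toMultigraph.Connected) :
    Module.finrank (ZMod 2) (S.freeFixedBicycles D) + (1 + Nat.card S.AxisEdge) =
      Module.finrank (ZMod 2) ((plusLaplaceForm h).orthogonal (vanishingPotentials hV)) := by
  rw [← map_orthogonal_eq_freeFixedBicycles h hV]
  set U := (plusLaplaceForm h).orthogonal (vanishingPotentials hV)
  set T := extendByReflection ∘ₗ (plus h).coboundary (ZMod 2)
  rw [← LinearMap.finrank_range_add_finrank_ker (T.domRestrict U), LinearMap.range_domRestrict]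
  congr 1
  -- `j` parametrizes the kernel: potentials constant on the vertices of G, with arbitrary values on
  -- the subdividing vertices. This is the source of `1 + Nat.card S.AxisEdge`.
  let j : ZMod 2 × (S.AxisEdge → ZMod 2) →ₗ[ZMod 2] U :=
    { toFun := fun p => ⟨S.plusPotential (fun _ => p.1) p.2,
        (plusPotential_mem_orthogonal_iff h hV).mpr ⟨fun _ => rfl, fun a _ => by simp⟩⟩
      map_add' := fun p q => Subtype.ext (funext (Sum.rec (fun _ => rfl) fun _ => rfl))
      map_smul' := fun c p => Subtype.ext (funext (Sum.rec (fun _ => rfl) fun _ => rfl)) }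
  have hj : Function.Injective j := by
    intro p q hpq
    have hpq' := congrArg Subtype.val hpq
    have h2 : p.2 = q.2 := funext fun e => congrFun hpq' (.inr e)
    refine Prod.ext ?_ h2
    obtain ⟨v | e⟩ := hconn.nonempty
    · exact congrFun hpq' (.inl v)
    · exact congrFun hpq' (.inl ⟨D.tail e, e, .inr e.2, h.tail_mem e⟩)
  have hrange : LinearMap.range j = LinearMap.ker (T.domRestrict U) := by
    apply le_antisymm
    · rintro _ ⟨p, rfl⟩
      rw [LinearMap.mem_ker]
      funext e
      refine S.edge_cases (P := fun e => _ = (0 : ZMod 2)) (fun l => ?_) (fun l => ?_)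
        (fun a => ?_) e <;> simp [T, j, LinearMap.domRestrict_apply]
    · rintro ⟨u, hu⟩ hTu
      obtain ⟨b, n, rfl⟩ := exists_eq_plusPotential u
      have H1 := ((plusPotential_mem_orthogonal_iff h hV).mp hu).1
      have hT : ∀ e, T (S.plusPotential b n) e = 0 := congrFun (LinearMap.mem_ker.mp hTu)
      -- The free values `n` are replaced by the value at the tail, so that the new potential is
      -- constant along every edge of G₊ and connectedness applies.
      have hconst := OrientedMultigraph.eq_of_connected hconn
        (w := S.plusPotential b fun e => b (D.tail e)) (by
          rintro (l | ⟨e, _ | _⟩)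
          · have := hT l
            simp only [T, LinearMap.comp_apply, extendByReflection_left,
              coboundary_plusPotential_left] at this
            exact sub_eq_zero.mp this
          · rfl
          · exact H1 e)
      obtain ⟨i⟩ := hconn.nonempty
      refine ⟨(S.plusPotential b (fun e => b (D.tail e)) i, n), Subtype.ext (funext ?_)⟩
      rintro (v | e)
      · exact hconst i (.inl v)
      · rfl
  rw [← hrange, LinearMap.finrank_range_of_inj hj, Module.finrank_prod, Module.finrank_self,
    Module.finrank_fintype_fun_eq_card, Nat.card_eq_fintype_card]

theorem finrank_freeFixedBicycles_add [Finite V]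
    (hV : ∀ v, S.φV v = v → ∃ e, (S.sideE e = -1 ∨ S.sideE e = 0) ∧ v ∈ G.ends e)
    (hconn : (plus h).toMultigraph.Connected) (hne : ∃ v, S.φV v = v) :
    Module.finrank (ZMod 2) (S.freeFixedBicycles D) + 1 + Nat.card S.AxisEdge =
      Module.finrank (ZMod 2) (plusMinusFixedBicycles h) + Nat.card {v : V // S.φV v = v} := by
  have h1 := finrank_vanishingPotentials hV
  have h2 := finrank_plusMinusFixedBicycles h hV hconn hne
  have h3 := finrank_freeFixedBicycles h hV hconn
  have h4 := LinearMap.BilinForm.finrank_add_finrank_orthogonal (isRefl_plusLaplaceForm h)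
    (vanishingPotentials hV)
  omega

end dimensions

end ReflectiveSymmetry

/-! ### The induced homomorphism and the main theorem. -/

namespace ReflectiveSymmetry

variable {V : Type u} {E : Type v} [Fintype E] {G : Multigraph V E} {S : ReflectiveSymmetry G}
  {D : OrientedMultigraph V E} (h : S.IsInvariantOrientation D)

/-- The class map of the disjoint union of `G₊` and `G₋`. -/
noncomputable def unionToCriticalGroup : (S.PlusEdge ⊕ S.MinusEdge → ℤ) →+
    (plus h).CriticalGroup × (minus h).CriticalGroup :=
  (((plus h).toCriticalGroup.prodMap (minus h).toCriticalGroup) ∘ₗ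
    (LinearEquiv.sumArrowLequivProdArrow S.PlusEdge S.MinusEdge ℤ ℤ).toLinearMap).toAddMonoidHom

theorem unionToCriticalGroup_apply (y : S.PlusEdge ⊕ S.MinusEdge → ℤ) :
    unionToCriticalGroup h y =
      ((plus h).toCriticalGroup (y ∘ Sum.inl), (minus h).toCriticalGroup (y ∘ Sum.inr)) := rfl

theorem unionToCriticalGroup_surjective : Function.Surjective (unionToCriticalGroup h) := by
  rintro ⟨a, b⟩
  obtain ⟨x, rfl⟩ := Submodule.mkQ_surjective _ a
  obtain ⟨y, rfl⟩ := Submodule.mkQ_surjective _ b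
  exact ⟨Sum.elim x y, rfl⟩

variable [Finite V]

theorem unionToCriticalGroup_eq_zero_iff (y : S.PlusEdge ⊕ S.MinusEdge → ℤ) :
    unionToCriticalGroup h y = 0 ↔
      y ∈ ((plus h).disjointUnion (minus h)).cycleSpace ℤ ⊔
        ((plus h).disjointUnion (minus h)).bondSpace ℤ := by
  rw [OrientedMultigraph.mem_cycleSpace_sup_bondSpace_disjointUnion, unionToCriticalGroup_apply,
    Prod.mk_eq_zero]
  exact and_congr (Submodule.Quotient.mk_eq_zero _) (Submodule.Quotient.mk_eq_zero _)

theorem exists_criticalGroup_hom : ∃ F : ((plus h).CriticalGroup × (minus h).CriticalGroup) →+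
    D.CriticalGroup, ∀ y, F (unionToCriticalGroup h y) = D.toCriticalGroup (S.fUnion y) := by
  let F := QuotientAddGroup.lift (unionToCriticalGroup h).ker
    (D.toCriticalGroup ∘ₗ S.fUnion).toAddMonoidHom fun y hy =>
      (Submodule.Quotient.mk_eq_zero _).mpr ((halfIsomorphism h).map_mem_sup
        ((unionToCriticalGroup_eq_zero_iff h y).mp hy))
  let e := QuotientAddGroup.quotientKerEquivOfSurjective _ (unionToCriticalGroup_surjective h)
  refine ⟨F.comp e.symm.toAddMonoidHom, fun y => ?_⟩
  have : e.symm (unionToCriticalGroup h y) = QuotientAddGroup.mk y :=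
    e.symm_apply_eq.mpr rfl
  change F (e.symm (unionToCriticalGroup h y)) = _
  rw [this]
  rfl

end ReflectiveSymmetry

/-- For a homomorphism of finite groups, the index of the image and the order of the kernel have the
same ratio as the orders of the groups. -/
theorem AddMonoidHom.natCard_coker_div_natCard_ker {A B : Type*} [AddCommGroup A] [AddCommGroup B]
    [Finite A] (F : A →+ B) :
    (Nat.card (B ⧸ F.range) : ℚ) / Nat.card F.ker = Nat.card B / Nat.card A := by
  have hA := AddSubgroup.card_eq_card_quotient_mul_card_addSubgroup F.ker
  have hB := AddSubgroup.card_eq_card_quotient_mul_card_addSubgroup F.range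
  rw [Nat.card_congr (QuotientAddGroup.quotientKerEquivRange F).toEquiv] at hA
  have h1 : (Nat.card F.ker : ℚ) ≠ 0 := Nat.cast_ne_zero.mpr Nat.card_pos.ne'
  have : Finite F.range := Finite.of_surjective _ F.rangeRestrict_surjective
  have h2 : (Nat.card F.range : ℚ) ≠ 0 := Nat.cast_ne_zero.mpr Nat.card_pos.ne'
  rw [hA, hB]
  push_cast
  field_simp

theorem mainTheorem1 {V : Type u} {E : Type v} [Fintype V] [Fintype E]
    (G : Multigraph V E) (S : ReflectiveSymmetry G) :
    (∃ D : OrientedMultigraph V E, S.IsInvariantOrientation D) ∧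
    ∀ (D : OrientedMultigraph V E) (h : S.IsInvariantOrientation D),
      ∃ fstar : ((ReflectiveSymmetry.plus h).CriticalGroup ×
          (ReflectiveSymmetry.minus h).CriticalGroup) →+ D.CriticalGroup,
        (∀ x y, fstar ((ReflectiveSymmetry.plus h).toCriticalGroup x,
          (ReflectiveSymmetry.minus h).toCriticalGroup y) = D.toCriticalGroup (S.f (x, y))) ∧
        (∀ a ∈ fstar.ker, 2 • a = 0) ∧
        (∀ c : D.CriticalGroup ⧸ fstar.range, 2 • c = 0) ∧
        Nonempty (fstar.ker ≃+ ReflectiveSymmetry.plusMinusFixedBicycles h) ∧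
        Nonempty ((D.CriticalGroup ⧸ fstar.range) ≃+ S.freeFixedBicycles D) ∧
        (S.FixedEdgesFormForest →
          Nonempty ((D.CriticalGroup ⧸ fstar.range) ≃+ S.fixedBicycles D)) ∧
        ((ReflectiveSymmetry.plus h).toMultigraph.Connected →
          (∃ v, S.φV v = v) →
          (∀ v, S.φV v = v → ∃ e, v ∈ G.ends e) →
          (Nat.card (D.CriticalGroup ⧸ fstar.range) : ℚ) / (Nat.card fstar.ker : ℚ) =
            (Nat.card D.CriticalGroup : ℚ) /
              (Nat.card ((ReflectiveSymmetry.plus h).CriticalGroup ×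
                (ReflectiveSymmetry.minus h).CriticalGroup) : ℚ) ∧
          (Nat.card D.CriticalGroup : ℚ) /
              (Nat.card ((ReflectiveSymmetry.plus h).CriticalGroup ×
                (ReflectiveSymmetry.minus h).CriticalGroup) : ℚ) =
            (2 : ℚ) ^ ((Nat.card {v : V // S.φV v = v} : ℤ) -
              (Nat.card {e : E // S.φE e = e} : ℤ) - 1)) := by
  refine ⟨S.exists_invariantOrientation, fun D h => ?_⟩
  obtain ⟨F, hF⟩ := ReflectiveSymmetry.exists_criticalGroup_hom h
  have hπ := ReflectiveSymmetry.unionToCriticalGroup_surjective h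
  have hker := ReflectiveSymmetry.unionToCriticalGroup_eq_zero_iff h
  have H := ReflectiveSymmetry.halfIsomorphism h
  have hK : Nonempty (F.ker ≃+ ReflectiveSymmetry.plusMinusFixedBicycles h) :=
    H.nonempty_ker_equiv hπ hker hF S.reduceModTwo_mem_invariant_iff
  have hC : Nonempty ((D.CriticalGroup ⧸ F.range) ≃+ S.freeFixedBicycles D) := by
    rw [S.freeFixedBicycles_eq]
    exact H.nonempty_coker_equiv hπ hF S.reduceModTwo_mem_axisFree_iff
  refine ⟨F, fun x y => hF (Sum.elim x y), fun a => H.two_smul_eq_zero_of_mem_ker hπ hker hF,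
    H.two_smul_coker_eq_zero hF, hK, hC, fun hS => ?_, fun hconn hne hV => ?_⟩
  · rwa [← ReflectiveSymmetry.freeFixedBicycles_eq_of_forest h hS]
  · have := (ReflectiveSymmetry.plus h).finite_criticalGroup
    have := (ReflectiveSymmetry.minus h).finite_criticalGroup
    have hdiv := F.natCard_coker_div_natCard_ker
    refine ⟨hdiv, ?_⟩
    have hV' : ∀ v, S.φV v = v → ∃ e, (S.sideE e = -1 ∨ S.sideE e = 0) ∧ v ∈ G.ends e := by
      intro v hv
      obtain ⟨e, he⟩ := hV v hv
      rcases hs : S.sideE e with _ | _ | _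
      · exact ⟨e, .inr hs, he⟩
      · exact ⟨e, .inl hs, he⟩
      -- A fixed endpoint of a right edge is also an endpoint of its mirror image, so every axis
      -- vertex belongs to G₊.
      · refine ⟨S.φE e, .inl ?_, ?_⟩
        · rw [S.sideE_φE, hs]
          rfl
        · rw [S.ends_φE]
          exact Sym2.mem_map.mpr ⟨v, he, hv⟩
    have hdim := ReflectiveSymmetry.finrank_freeFixedBicycles_add h hV' hconn hne
    have hE : Nat.card S.AxisEdge = Nat.card {e : E // S.φE e = e} :=
      Nat.card_congr (Equiv.subtypeEquivRight S.sideE_eq_zero_iff)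
    rw [← hdiv, Nat.card_congr hK.some.toEquiv, Nat.card_congr hC.some.toEquiv,
      Module.natCard_eq_pow_finrank (K := ZMod 2) (V := S.freeFixedBicycles D),
      Module.natCard_eq_pow_finrank (K := ZMod 2)
        (V := ReflectiveSymmetry.plusMinusFixedBicycles h),
      Nat.card_zmod]
    push_cast
    rw [← zpow_natCast, ← zpow_natCast, ← zpow_sub₀ two_ne_zero]
    congr 1
    omega
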